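/- Let $X_1,X_2,X_3$ be the basis of $\mathfrak{so}(3)$ with $(X_i)_{jk}=-\epsilon_{ijk}$, let $(V_m,\rho_m)$ be the irreducible $m$-dimensional complex representation of $\mathfrak{so}(3)$ in an orthonormal basis in which it is unitary (the standard spin-$\frac{m-1}{2}$ matrices), and put $Y_i^m=\rho_m(X_i)$. For $n\in\{1,3\}$ there is a triple of linear maps $B_1^n,B_2^n,B_3^n:V_n\to V_{n+2}$ with $$Y_j^{n+2}B_k^n-B_k^nY_j^n=\sum_{i}\epsilon_{ijk}B_i^n\quad(1\le j,k\le 3),\qquad \sum_iB_i^n(B_i^n)^*=\mathbb 1_{n+2}.$$ Fix any such triples. For real numbers $f_1,f_2,g_0,g_1$ let $$A_i(f_1,f_2,g_0,g_1)=\begin{pmatrix} f_2Y_i^5 & g_1B_i^3 & 0\\ -g_1(B_i^3)^* & f_1Y_i^3 & g_0B_i^1\\ 0 & -g_0(B_i^1)^* & 0\end{pmatrix},\qquad i=1,2,3 .$$ A solution of Nahm's equations on a nonempty open interval $I\subseteq\mathbb R$ is a triple $\mathcal T=(T_1,T_2,T_3)$ of functions $I\to\mathfrak{su}(9)$ with $\dot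 T_1=[T_2,T_3]$, $\dot T_2=[T_3,T_1]$, $\dot T_3=[T_1,T_2]$. It is spherically symmetric if for every $A\in\mathrm{SO}(3)$ there is $U_A\in\mathrm{SU}(9)$ with $\sum_jA_{ij}T_j(t)=U_A^{-1}T_i(t)U_A$ for all $i$ and all $t\in I$; a triple $Y_1,Y_2,Y_3\in\mathfrak{su}(9)$ generates the symmetry if $[Y_i,T_j]=\sum_k\epsilon_{ijk}T_k$ on $I$ for all $i,j$. It is irreducible if no subspace of $\mathbb C^9$ other than $0$ and $\mathbb C^9$ is invariant under all $T_i(t)$. 1. Let $\mathcal T$ be a spherically symmetric solution of Nahm's equations on a nonempty open interval $I$, with generators $Y_1,Y_2,Y_3\in\mathfrak{su}(9)$ satisfying $[Y_i,Y_j]=\sum_k\epsilon_{ijk}Y_k$ and such that the representation $X_i\mapsto Y_i$ is isomorphic to $V_5\oplus V_3\oplus V_1$. Then there are a (constant) $U\in\mathrm{SU}(9)$ and real analytic functions $f_1,f_2,g_0,g_1:I\to\mathbb R$ such that, for all $i$, $UY_iU^{-1}=\mathrm{diag}(Y_i^5,Y_i^3,Y_i^1)$ and $UT_iU^{-1}=A_i(f_1,f_2,g_0,g_1)$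 on $I$, and $$\dot f_1=f_1^2+g_0^2-\tfrac56g_1^2,\quad \dot f_2=f_2^2+\tfrac12g_1^2,\quad \dot g_0=2f_1g_0,\quad \dot g_1=(3f_2-f_1)g_1. \tag{$*$}$$ 2. The functions $$f_1(t)=f_2(t)=-\frac{t}{t^2-1},\qquad g_0(t)=\frac{\sqrt8}{\sqrt3\,(t^2-1)},\qquad g_1(t)=\frac{\sqrt2}{t^2-1}$$ solve $(*)$ on $(-1,1)$, and this solution does not extend to a solution on a larger open interval. They have simple poles at $\pm1$, with residues $$\mathrm{Res}(f_1,\pm1)=\mathrm{Res}(f_2,\pm1)=-\tfrac12,\quad \mathrm{Res}(g_0,\pm1)=\pm\sqrt{\tfrac23},\quad \mathrm{Res}(g_1,\pm1)=\pm\tfrac1{\sqrt2}.$$ 3. For these functions, $T_i=A_i(f_1,f_2,g_0,g_1)$ is a solution of Nahm's equations on $(-1,1)$ which does not extend to a larger open interval; it is spherically symmetric with generators $\mathrm{diag}(Y_i^5,Y_i^3,Y_i^1)$, and it is irreducible. At each of the two points $t_0=\pm1$, the residues $\mathrm{Res}(T_i,t_0)$ lie in $\mathfrak{su}(9)$, and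 $X_i\mapsto-\mathrm{Res}(T_i,t_0)$ is a representation of $\mathfrak{so}(3)$ isomorphic to $V_3^{\oplus3}$. -/

import Mathlib

open Matrix Set Filter Topology

/-- The Levi-Civita symbol on the indices `0, 1, 2`. -/
def leviCivita (i j k : Fin 3) : ℂ :=
  if j = i + 1 ∧ k = i + 2 then 1 else if j = i + 2 ∧ k = i + 1 then -1 else 0

/-- Membership in `𝔰𝔲(n)`: skew-Hermitian and traceless. -/
def IsSu {n : Type*} [Fintype n] (M : Matrix n n ℂ) : Prop :=
  Mᴴ = -M ∧ M.trace = 0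

/-- A triple `(Y₁, Y₂, Y₃)` of matrices satisfies the commutation relations
`[Yᵢ, Yⱼ] = ∑ₖ εᵢⱼₖ Yₖ` of the standard basis `(X₁, X₂, X₃)` of `𝔰𝔬(3)`, that is,
`Xᵢ ↦ Yᵢ` is a complex representation of `𝔰𝔬(3)`. -/
def IsSO3Rep {n : Type*} [Fintype n] (Y : Fin 3 → Matrix n n ℂ) : Prop :=
  ∀ i j, Y i * Y j - Y j * Y i = ∑ k, leviCivita i j k • Y k

/-- Isomorphism of the representations given by two triples. -/
def RepIso {m n : Type*} [Fintype m] [Fintype n]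
    (Y : Fin 3 → Matrix m m ℂ) (Z : Fin 3 → Matrix n n ℂ) : Prop :=
  ∃ P : (m → ℂ) ≃ₗ[ℂ] (n → ℂ), ∀ i v, P (Y i *ᵥ v) = Z i *ᵥ P v

/-- The raising operator of the `m`-dimensional irreducible representation, in the orthonormal
basis of weight vectors of weights `(m-1)/2, (m-3)/2, …, -(m-1)/2`. -/
noncomputable def raising (m : ℕ) : Matrix (Fin m) (Fin m) ℂ :=
  Matrix.of fun a b =>
    if (b : ℕ) = a + 1 then ((Real.sqrt ((b : ℝ) * ((m : ℝ) - (b : ℝ))) : ℝ) : ℂ) else 0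

/-- The `m`-dimensional irreducible complex representation `(V_m, ρ_m)` of `𝔰𝔬(3)`, in its standard
unitary model: `irrep m i = ρ_m(Xᵢ) = -√-1 Jᵢ`, where `J₁, J₂, J₃` are the spin matrices of
spin `(m-1)/2`. -/
noncomputable def irrep (m : ℕ) : Fin 3 → Matrix (Fin m) (Fin m) ℂ :=
  ![(-Complex.I / 2) • (raising m + (raising m)ᴴ),
    (-1 / 2 : ℂ) • (raising m - (raising m)ᴴ),
    (-Complex.I) • Matrix.diagonal fun a : Fin m => ((m : ℂ) - 1) / 2 - ((a : ℕ) : ℂ)]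

/-- `B = (B₁, B₂, B₃)` is an `𝔰𝔬(3)`-invariant triple of linear maps `V_n → V_{n+2}`
(a generator of the one-dimensional invariant part of `V_{n+2} ⊗ V_n^* ⊗ V_3`),
normalized by `∑ᵢ Bᵢ Bᵢ^* = 1`; such a triple is unique up to a factor in `U(1)`. -/
def IsInvariantTriple (n : ℕ) (B : Fin 3 → Matrix (Fin (n + 2)) (Fin n) ℂ) : Prop :=
  (∀ j k, irrep (n + 2) j * B k - B k * irrep n j = ∑ i, leviCivita j k i • B i) ∧
    ∑ i, B i * (B i)ᴴ = 1

/-- `T : I → 𝔰𝔲(n)^{⊕3}` is a solution of Nahm's equations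
`T₁' = [T₂, T₃]`, `T₂' = [T₃, T₁]`, `T₃' = [T₁, T₂]` on the nonempty open interval `I`. -/
structure IsNahmSolution {n : Type*} [Fintype n] (T : ℝ → Fin 3 → Matrix n n ℂ) (I : Set ℝ) :
    Prop where
  isOpen : IsOpen I
  isConnected : IsConnected I
  isSu : ∀ t ∈ I, ∀ i, IsSu (T t i)
  hasDerivAt : ∀ t ∈ I, ∀ i a b, HasDerivAt (fun s => T s i a b)
    ((T t (i + 1) * T t (i + 2) - T t (i + 2) * T t (i + 1)) a b) t

/-- Spherical symmetry: for every `A ∈ SO(3)` there is `U ∈ SU(n)` with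
`∑ⱼ Aᵢⱼ Tⱼ = U⁻¹ Tᵢ U` on `I`. -/
def IsSphericallySymmetric {n : Type*} [Fintype n] [DecidableEq n]
    (T : ℝ → Fin 3 → Matrix n n ℂ) (I : Set ℝ) : Prop :=
  ∀ A ∈ Matrix.specialOrthogonalGroup (Fin 3) ℝ, ∃ U ∈ Matrix.specialUnitaryGroup n ℂ,
    ∀ t ∈ I, ∀ i, ∑ j, (A i j : ℂ) • T t j = Uᴴ * T t i * U

/-- `(Y₁, Y₂, Y₃) ∈ 𝔰𝔲(n)^{⊕3}` are generators of the spherical symmetry of `T` on `I`, that is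
`[Yᵢ, Tⱼ] = ∑ₖ εᵢⱼₖ Tₖ`. -/
def AreGenerators {n : Type*} [Fintype n]
    (Y : Fin 3 → Matrix n n ℂ) (T : ℝ → Fin 3 → Matrix n n ℂ) (I : Set ℝ) : Prop :=
  (∀ i, IsSu (Y i)) ∧
    ∀ t ∈ I, ∀ i j, Y i * T t j - T t j * Y i = ∑ k, leviCivita i j k • T t k

/-- Irreducibility: no proper nonzero subspace is invariant under all `Tᵢ(t)`, `t ∈ I`. -/
def IsIrreducibleDatum {n : Type*} [Fintype n]
    (T : ℝ → Fin 3 → Matrix n n ℂ) (I : Set ℝ) : Prop :=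
  ∀ W : Submodule ℂ (n → ℂ), (∀ t ∈ I, ∀ i, ∀ v ∈ W, T t i *ᵥ v ∈ W) → W = ⊥ ∨ W = ⊤

/-- A solution of Nahm's equations on `I` which does not extend to a larger open interval. -/
def IsMaximalNahmSolution {n : Type*} [Fintype n]
    (T : ℝ → Fin 3 → Matrix n n ℂ) (I : Set ℝ) : Prop :=
  IsNahmSolution T I ∧ ∀ (J : Set ℝ) (S : ℝ → Fin 3 → Matrix n n ℂ),
    IsNahmSolution S J → I ⊆ J → (∀ t ∈ I, S t = T t) → J = I

/-- The coordinates of `V_5 ⊕ V_3 ⊕ V_1`. -/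
abbrev Idx531 : Type := Fin 5 ⊕ Fin 3 ⊕ Fin 1

/-- The representation `V_5 ⊕ V_3 ⊕ V_1`. -/
noncomputable def rep531 (i : Fin 3) : Matrix Idx531 Idx531 ℂ :=
  fromBlocks (irrep 5 i) 0 0 (fromBlocks (irrep 3 i) 0 0 (irrep 1 i))

/-- The representation `V_3 ⊕ V_3 ⊕ V_3`. -/
noncomputable def rep333 (i : Fin 3) : Matrix (Fin 3 × Fin 3) (Fin 3 × Fin 3) ℂ :=
  blockDiagonal fun _ : Fin 3 => irrep 3 i

/-- The block tridiagonal matrix with rows `(f₂ Yᵢ⁵, g₁ Bᵢ³, 0)`, `(-g₁ (Bᵢ³)^*, f₁ Yᵢ³, g₀ Bᵢ¹)`,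
`(0, -g₀ (Bᵢ¹)^*, 0)`. -/
noncomputable def ansatz531 (B₃ : Fin 3 → Matrix (Fin 5) (Fin 3) ℂ)
    (B₁ : Fin 3 → Matrix (Fin 3) (Fin 1) ℂ) (f₁ f₂ g₀ g₁ : ℝ) (i : Fin 3) :
    Matrix Idx531 Idx531 ℂ :=
  fromBlocks ((f₂ : ℂ) • irrep 5 i) (fromCols ((g₁ : ℂ) • B₃ i) 0)
    (fromRows (-((g₁ : ℂ) • (B₃ i)ᴴ)) 0)
    (fromBlocks ((f₁ : ℂ) • irrep 3 i) ((g₀ : ℂ) • B₁ i) (-((g₀ : ℂ) • (B₁ i)ᴴ)) 0)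

/-- The system `f₁' = f₁² + g₀² - (5/6) g₁²`, `f₂' = f₂² + (1/2) g₁²`, `g₀' = 2 f₁ g₀`,
`g₁' = (3 f₂ - f₁) g₁` on `I`. -/
def IsSolution531 (f₁ f₂ g₀ g₁ : ℝ → ℝ) (I : Set ℝ) : Prop :=
  ∀ t ∈ I,
    HasDerivAt f₁ (f₁ t ^ 2 + g₀ t ^ 2 - 5 / 6 * g₁ t ^ 2) t ∧
    HasDerivAt f₂ (f₂ t ^ 2 + 1 / 2 * g₁ t ^ 2) t ∧
    HasDerivAt g₀ (2 * f₁ t * g₀ t) t ∧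
    HasDerivAt g₁ ((3 * f₂ t - f₁ t) * g₁ t) t

/-- A solution of the system on `I` which does not extend to a larger open interval. -/
def IsMaximalSolution531 (f₁ f₂ g₀ g₁ : ℝ → ℝ) (I : Set ℝ) : Prop :=
  IsSolution531 f₁ f₂ g₀ g₁ I ∧ ∀ (J : Set ℝ) (F₁ F₂ G₀ G₁ : ℝ → ℝ),
    IsOpen J → IsConnected J → IsSolution531 F₁ F₂ G₀ G₁ J → I ⊆ J →
    (∀ t ∈ I, F₁ t = f₁ t ∧ F₂ t = f₂ t ∧ G₀ t = g₀ t ∧ G₁ t = g₁ t) → J = I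

/-- Near `t₀`, `f(t) = r / (t - t₀) + h(t)` with `h` real analytic at `t₀`: the function has at most
a simple pole at `t₀`, with residue `r` (and a simple pole if and only if `r ≠ 0`). -/
def HasResidueAt {E : Type*} [NormedAddCommGroup E] [NormedSpace ℝ E]
    (f : ℝ → E) (t₀ : ℝ) (r : E) : Prop :=
  ∃ h : ℝ → E, AnalyticAt ℝ h t₀ ∧ ∀ᶠ t in 𝓝[≠] t₀, f t = (t - t₀)⁻¹ • r + h t

/-- A simple pole at `t₀` with residue `r`. -/
def HasSimplePoleAt (f : ℝ → ℝ) (t₀ r : ℝ) : Prop :=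
  r ≠ 0 ∧ HasResidueAt f t₀ r

/-- The function `-t / (t² - 1)`. -/
noncomputable def solF (t : ℝ) : ℝ := -(t / (t ^ 2 - 1))

/-- The function `√8 / (√3 (t² - 1))`. -/
noncomputable def solG₀ (t : ℝ) : ℝ := Real.sqrt 8 / (Real.sqrt 3 * (t ^ 2 - 1))

/-- The function `√2 / (t² - 1)`. -/
noncomputable def solG₁ (t : ℝ) : ℝ := Real.sqrt 2 / (t ^ 2 - 1)

/-!
A triple `T` that is equivariant under `V₅ ⊕ V₃ ⊕ V₁` decomposes into equivariant triples between the
summands. Schur's lemma for such triples (`IsEquivariantTriple.eq_smul` and the lemmas after it) holds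
by direct computation: the third component preserves weights, its entries satisfy a three-term
recurrence, and it determines the other two components. So the triples `V₃ → V₅` and `V₁ → V₃` are
unique up to a scalar, triples `V₅ → V₅` and `V₃ → V₃` are multiples of the representation itself, and
triples `V₁ → V₅` and `V₁ → V₁` vanish. A skew-Hermitian equivariant triple is therefore a
`complexAnsatz`, with real diagonal and complex off-diagonal coefficients (`exists_eq_complexAnsatz`).

All further algebra rests on two quadratic identities for the unitary normalizations, namely
`Bₖ Yᵢ = ½ Yᵢ Bₖ + ½ Bᵢ Yₖ` (`IsInvariantTriple.mul_irrep`) and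
`Yₖ Yᵢ = ½ Yᵢ Yₖ - Bᵢ* Bₖ + ⅔ Dᵢ Dₖ*` (`IsInvariantTriple.irrep_mul_irrep`), where `B` and `D` are
the triples `V₃ → V₅` and `V₁ → V₃`, together with their commutators and contractions. They need to be
verified for one explicit choice of the triples only, since any other choice differs by phases. They
turn Nahm's equations for the ansatz into the system for the coefficients
(`complexAnsatz_commutator`).

For a symmetric solution, an isomorphism of skew-Hermitian representations can be made unitary
(`RepIso.exists_unitary`), so the generators may be taken to be `rep531`. The complex off-diagonal
coefficients solve linear equations with real coefficients, hence have constant phases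
(`exists_eq_phase_mul_of_hasDerivAt`), which a diagonal unitary removes
(`blockPhase_mul_complexAnsatz_mul`). The coefficients are analytic because the system is quadratic:
the recursively defined power series converges and is the solution by uniqueness
(`analyticOnNhd_of_quadratic`).

The explicit solution is not extendable, because a function continuous at `±1` cannot agree with
`-t / (t² - 1)` on `(-1, 1)`. The generators integrate to unitaries that implement rotations about
the coordinate axes, and Euler angles give all rotations (`isSphericallySymmetric_of_areGenerators`).
For irreducibility, the values of the solution at two times recover the generators, whose weight
operator and Casimir operator separate the weight vectors; nonzero entries connect all of these
(`isIrreducibleDatum_sol`). Finally, for the negative residues, the columns `(Bₖ, β Yₖ, γ Dₖ*)` with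
suitable scalars `β`, `γ` are orthonormal, and by the two quadratic identities each `k` yields an
embedding of `V₃` into the representation that they define (`repIso_rep333`).
-/

/-! ### The spin matrices and the invariant triples -/

/-- The complex number `√2`. -/
noncomputable def rootTwo : ℂ := ((√2 : ℝ) : ℂ)

/-- The complex number `√3`. -/
noncomputable def rootThree : ℂ := ((√3 : ℝ) : ℂ)

theorem rootTwo_sq : rootTwo ^ 2 = 2 := by
  rw [rootTwo, ← Complex.ofReal_pow, Real.sq_sqrt (by norm_num)]; norm_num

theorem rootThree_sq : rootThree ^ 2 = 3 := by
  rw [rootThree, ← Complex.ofReal_pow, Real.sq_sqrt (by norm_num)]; norm_num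

@[simp] theorem conj_rootTwo : (starRingEnd ℂ) rootTwo = rootTwo := Complex.conj_ofReal _

@[simp] theorem conj_rootThree : (starRingEnd ℂ) rootThree = rootThree := Complex.conj_ofReal _

theorem irrep_zero_apply (m : ℕ) (a b : Fin m) :
    irrep m 0 a b = -Complex.I / 2 * (raising m a b + star (raising m b a)) := rfl

theorem irrep_one_apply (m : ℕ) (a b : Fin m) :
    irrep m 1 a b = -1 / 2 * (raising m a b - star (raising m b a)) := rfl

theorem irrep_two_apply (m : ℕ) (a b : Fin m) :
    irrep m 2 a b = if a = b then -Complex.I * (((m : ℂ) - 1) / 2 - ((a : ℕ) : ℂ)) else 0 := by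
  change -Complex.I * diagonal _ a b = _
  rw [diagonal_apply, mul_ite, mul_zero]

theorem raising_apply (m : ℕ) (a b : Fin m) : raising m a b =
    if (b : ℕ) = a + 1 then ((√((b : ℝ) * ((m : ℝ) - (b : ℝ))) : ℝ) : ℂ) else 0 := rfl

theorem ofReal_sqrt_two : ((√2 : ℝ) : ℂ) = rootTwo := rfl

theorem raising_five (a b : Fin 5) : raising 5 a b =
    !![0, 2, 0, 0, 0;
       0, 0, rootTwo * rootThree, 0, 0;
       0, 0, 0, rootTwo * rootThree, 0;
       0, 0, 0, 0, 2;
       0, 0, 0, 0, 0] a b := by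
  fin_cases a <;> fin_cases b <;> simp [raising_apply] <;> norm_num <;>
    simp only [rootTwo, rootThree, mul_comm]

theorem raising_three (a b : Fin 3) :
    raising 3 a b = !![0, rootTwo, 0; 0, 0, rootTwo; 0, 0, 0] a b := by
  fin_cases a <;> fin_cases b <;> simp [raising_apply] <;> ring_nf <;>
    simp [ofReal_sqrt_two]

theorem irrep_one (i : Fin 3) : irrep 1 i = 0 := by
  have h : ∀ a b, raising 1 a b = 0 := fun a b => by rw [raising_apply, if_neg (by omega)]
  ext a b
  fin_cases i
  · change irrep 1 0 a b = 0
    rw [irrep_zero_apply, h, h, star_zero, add_zero, mul_zero]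
  · change irrep 1 1 a b = 0
    rw [irrep_one_apply, h, h, star_zero, sub_zero, mul_zero]
  · change irrep 1 2 a b = 0
    rw [irrep_two_apply, Subsingleton.elim a 0, Subsingleton.elim b 0]
    simp

theorem irrep_five_zero : irrep 5 0 =
    (-Complex.I / 2) •
    !![0, 2, 0, 0, 0;
       2, 0, rootTwo * rootThree, 0, 0;
       0, rootTwo * rootThree, 0, rootTwo * rootThree, 0;
       0, 0, rootTwo * rootThree, 0, 2;
       0, 0, 0, 2, 0] := by
  ext a b
  fin_cases a <;> fin_cases b <;> simp [irrep_zero_apply, raising_five, mul_comm]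

theorem irrep_five_one : irrep 5 1 =
    (1 / 2 : ℂ) •
    !![0, -2, 0, 0, 0;
       2, 0, -(rootTwo * rootThree), 0, 0;
       0, rootTwo * rootThree, 0, -(rootTwo * rootThree), 0;
       0, 0, rootTwo * rootThree, 0, -2;
       0, 0, 0, 2, 0] := by
  ext a b
  fin_cases a <;> fin_cases b <;> simp [irrep_one_apply, raising_five] <;> ring

theorem irrep_five_two : irrep 5 2 = Complex.I •
    !![-2, 0, 0, 0, 0;
       0, -1, 0, 0, 0;
       0, 0, 0, 0, 0;
       0, 0, 0, 1, 0;
       0, 0, 0, 0, 2] := by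
  ext a b
  fin_cases a <;> fin_cases b <;> simp [irrep_two_apply] <;> ring

theorem irrep_three_zero : irrep 3 0 =
    (-Complex.I / 2 * rootTwo) • !![0, 1, 0; 1, 0, 1; 0, 1, 0] := by
  ext a b
  fin_cases a <;> fin_cases b <;> simp [irrep_zero_apply, raising_three]

theorem irrep_three_one : irrep 3 1 =
    (1 / 2 * rootTwo) • !![0, -1, 0; 1, 0, -1; 0, 1, 0] := by
  ext a b
  fin_cases a <;> fin_cases b <;> simp [irrep_one_apply, raising_three] <;> ring

theorem irrep_three_two : irrep 3 2 = Complex.I • !![-1, 0, 0; 0, 0, 0; 0, 0, 1] := by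
  ext a b
  fin_cases a <;> fin_cases b <;> simp [irrep_two_apply] <;> ring

/-- The invariant triple `V₃ → V₅`. -/
noncomputable def stdTriple₃ : Fin 3 → Matrix (Fin 5) (Fin 3) ℂ :=
  ![!![-(rootTwo / 2), 0, 0;
       0, -(1 / 2), 0;
       rootThree / 6, 0, -(rootThree / 6);
       0, 1 / 2, 0;
       0, 0, rootTwo / 2],
    Complex.I •
    !![rootTwo / 2, 0, 0;
       0, 1 / 2, 0;
       rootThree / 6, 0, rootThree / 6;
       0, 1 / 2, 0;
       0, 0, rootTwo / 2],
    !![0, 0, 0;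
       rootTwo / 2, 0, 0;
       0, rootTwo * rootThree / 3, 0;
       0, 0, rootTwo / 2;
       0, 0, 0]]

/-- The invariant triple `V₁ → V₃`. -/
noncomputable def stdTriple₁ : Fin 3 → Matrix (Fin 3) (Fin 1) ℂ :=
  ![!![-(rootTwo / 2); 0; rootTwo / 2],
    Complex.I • !![rootTwo / 2; 0; rootTwo / 2],
    !![0; 1; 0]]

/-! ### Matrix identities between the spin matrices and the invariant triples -/

theorem Fin.eq_zero_or_one_or_two (i : Fin 3) : i = 0 ∨ i = 1 ∨ i = 2 := by
  fin_cases i <;> simp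

theorem isSO3Rep_of_commutator {n : Type*} [Fintype n] {Y : Fin 3 → Matrix n n ℂ}
    (h : ∀ i, Y (i + 1) * Y (i + 2) - Y (i + 2) * Y (i + 1) = Y i) : IsSO3Rep Y := by
  have h0 : Y 1 * Y 2 - Y 2 * Y 1 = Y 0 := h 0
  have h1 : Y 2 * Y 0 - Y 0 * Y 2 = Y 1 := h 1
  have h2 : Y 0 * Y 1 - Y 1 * Y 0 = Y 2 := h 2
  intro i j
  have e0 : Y 2 * Y 1 - Y 1 * Y 2 = -Y 0 := by rw [← h0, neg_sub]
  have e1 : Y 0 * Y 2 - Y 2 * Y 0 = -Y 1 := by rw [← h1, neg_sub]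
  have e2 : Y 1 * Y 0 - Y 0 * Y 1 = -Y 2 := by rw [← h2, neg_sub]
  fin_cases i <;> fin_cases j <;> simp [leviCivita, h0, h1, h2, e0, e1, e2]

section Tables

theorem conjTranspose_stdTriple₃ (i : Fin 3) : (stdTriple₃ i)ᴴ =
    (![!![-(rootTwo / 2), 0, rootThree / 6, 0, 0;
          0, -(1 / 2), 0, 1 / 2, 0;
          0, 0, -(rootThree / 6), 0, rootTwo / 2],
       (-Complex.I) •
       !![rootTwo / 2, 0, rootThree / 6, 0, 0;
          0, 1 / 2, 0, 1 / 2, 0;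
          0, 0, rootThree / 6, 0, rootTwo / 2],
       !![0, rootTwo / 2, 0, 0, 0;
          0, 0, rootTwo * rootThree / 3, 0, 0;
          0, 0, 0, rootTwo / 2, 0]] : Fin 3 → Matrix (Fin 3) (Fin 5) ℂ) i := by
  ext a b
  rw [conjTranspose_apply]
  obtain rfl | rfl | rfl := Fin.eq_zero_or_one_or_two i <;> fin_cases a <;> fin_cases b <;>
    simp [stdTriple₃]

theorem conjTranspose_stdTriple₁ (i : Fin 3) : (stdTriple₁ i)ᴴ =
    (![!![-(rootTwo / 2), 0, rootTwo / 2], (-Complex.I) • !![rootTwo / 2, 0, rootTwo / 2],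
       !![0, 1, 0]] : Fin 3 → Matrix (Fin 1) (Fin 3) ℂ) i := by
  ext a b
  rw [conjTranspose_apply]
  obtain rfl | rfl | rfl := Fin.eq_zero_or_one_or_two i <;> fin_cases a <;> fin_cases b <;>
    simp [stdTriple₁]

attribute [local simp] irrep_five_zero irrep_five_one irrep_five_two irrep_three_zero
  irrep_three_one irrep_three_two stdTriple₃ stdTriple₁ conjTranspose_stdTriple₃
  conjTranspose_stdTriple₁ leviCivita Fin.sum_univ_three

set_option maxHeartbeats 1000000 in
theorem isSO3Rep_irrep_five : IsSO3Rep (irrep 5) := by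
  refine isSO3Rep_of_commutator fun i => ?_
  ext a b
  obtain rfl | rfl | rfl := Fin.eq_zero_or_one_or_two i <;> simp only [Fin.reduceAdd, zero_add] <;>
    simp <;> fin_cases a <;> fin_cases b <;> simp <;>
    grind [rootTwo_sq, rootThree_sq, Complex.I_sq]

theorem isSO3Rep_irrep_three : IsSO3Rep (irrep 3) := by
  refine isSO3Rep_of_commutator fun i => ?_
  ext a b
  obtain rfl | rfl | rfl := Fin.eq_zero_or_one_or_two i <;> simp only [Fin.reduceAdd, zero_add] <;>
    simp <;> fin_cases a <;> fin_cases b <;> simp <;>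
    grind [rootTwo_sq, rootThree_sq, Complex.I_sq]

set_option maxHeartbeats 1000000 in
/-- The equivariant families of maps `V₃ → V₅` indexed by `V₃ ⊗ V₃` form a two-dimensional space, so
the three families `Bₖ Yᵢ`, `Yᵢ Bₖ`, `Bᵢ Yₖ` satisfy a linear relation. -/
theorem stdTriple₃_mul_irrep (i k : Fin 3) : stdTriple₃ k * irrep 3 i =
    (1 / 2 : ℂ) • (irrep 5 i * stdTriple₃ k) + (1 / 2 : ℂ) • (stdTriple₃ i * irrep 3 k) := by
  ext a b
  obtain rfl | rfl | rfl := Fin.eq_zero_or_one_or_two i <;>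
    obtain rfl | rfl | rfl := Fin.eq_zero_or_one_or_two k <;>
    simp <;> fin_cases a <;> fin_cases b <;> simp <;>
    grind [rootTwo_sq, rootThree_sq, Complex.I_sq]

set_option maxHeartbeats 1000000 in
theorem irrep_three_mul_irrep_three (i k : Fin 3) :
    irrep 3 k * irrep 3 i = (1 / 2 : ℂ) • (irrep 3 i * irrep 3 k) -
      (stdTriple₃ i)ᴴ * stdTriple₃ k + (2 / 3 : ℂ) • (stdTriple₁ i * (stdTriple₁ k)ᴴ) := by
  rw [conjTranspose_stdTriple₃, conjTranspose_stdTriple₁]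
  ext a b
  obtain rfl | rfl | rfl := Fin.eq_zero_or_one_or_two i <;>
    obtain rfl | rfl | rfl := Fin.eq_zero_or_one_or_two k <;>
    simp <;> fin_cases a <;> fin_cases b <;> simp <;>
    grind [rootTwo_sq, rootThree_sq, Complex.I_sq]

theorem sum_stdTriple₃_mul_conjTranspose : ∑ i, stdTriple₃ i * (stdTriple₃ i)ᴴ = 1 := by
  simp only [conjTranspose_stdTriple₃]
  ext a b
  simp
  fin_cases a <;> fin_cases b <;> simp <;> grind [rootTwo_sq, rootThree_sq, Complex.I_sq]

theorem stdTriple₃_mul_irrep_sub (j k : Fin 3) :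
    stdTriple₃ k * irrep 3 j - stdTriple₃ j * irrep 3 k = ∑ i, leviCivita j k i • stdTriple₃ i := by
  ext a b
  obtain rfl | rfl | rfl := Fin.eq_zero_or_one_or_two j <;>
    obtain rfl | rfl | rfl := Fin.eq_zero_or_one_or_two k <;>
    simp <;> fin_cases a <;> fin_cases b <;> simp <;>
    grind [rootTwo_sq, rootThree_sq, Complex.I_sq]

theorem stdTriple₃_equivariant (j k : Fin 3) :
    irrep 5 j * stdTriple₃ k - stdTriple₃ k * irrep 3 j =
      ∑ i, leviCivita j k i • stdTriple₃ i := by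
  rw [← stdTriple₃_mul_irrep_sub]
  linear_combination (norm := module) (-2 : ℂ) • stdTriple₃_mul_irrep j k

theorem stdTriple₁_equivariant (j k : Fin 3) :
    irrep 3 j * stdTriple₁ k - stdTriple₁ k * irrep 1 j =
      ∑ i, leviCivita j k i • stdTriple₁ i := by
  rw [irrep_one, Matrix.mul_zero, sub_zero]
  ext a b
  obtain rfl | rfl | rfl := Fin.eq_zero_or_one_or_two j <;>
    obtain rfl | rfl | rfl := Fin.eq_zero_or_one_or_two k <;>
    simp <;> fin_cases a <;> fin_cases b <;> simp <;>
    grind [rootTwo_sq, rootThree_sq, Complex.I_sq]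

theorem sum_stdTriple₁_mul_conjTranspose : ∑ i, stdTriple₁ i * (stdTriple₁ i)ᴴ = 1 := by
  simp only [conjTranspose_stdTriple₁]
  ext a b
  simp
  fin_cases a <;> fin_cases b <;> simp <;> grind [rootTwo_sq, rootThree_sq, Complex.I_sq]

theorem sum_conjTranspose_stdTriple₁_mul :
    ∑ k, (stdTriple₁ k)ᴴ * stdTriple₁ k = (3 : ℂ) • 1 := by
  simp only [conjTranspose_stdTriple₁]
  ext a b
  fin_cases a; fin_cases b
  simp
  grind [rootTwo_sq, rootThree_sq, Complex.I_sq]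

theorem sum_stdTriple₃_mul_irrep : ∑ k, stdTriple₃ k * irrep 3 k = 0 := by
  ext a b
  simp
  fin_cases a <;> fin_cases b <;> simp <;> grind [rootTwo_sq, rootThree_sq, Complex.I_sq]

theorem sum_stdTriple₃_mul_stdTriple₁ : ∑ k, stdTriple₃ k * stdTriple₁ k = 0 := by
  ext a b
  simp
  fin_cases a <;> fin_cases b <;> simp <;> grind [rootTwo_sq, rootThree_sq, Complex.I_sq]

theorem stdTriple₃_mul_stdTriple₁_comm (i k : Fin 3) :
    stdTriple₃ i * stdTriple₁ k = stdTriple₃ k * stdTriple₁ i := by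
  ext a b
  obtain rfl | rfl | rfl := Fin.eq_zero_or_one_or_two i <;>
    obtain rfl | rfl | rfl := Fin.eq_zero_or_one_or_two k <;>
    simp <;> fin_cases a <;> fin_cases b <;> simp <;>
    grind [rootTwo_sq, rootThree_sq, Complex.I_sq]

set_option maxHeartbeats 1000000 in
theorem stdTriple₃_commutator (i : Fin 3) :
    stdTriple₃ (i + 1) * (stdTriple₃ (i + 2))ᴴ - stdTriple₃ (i + 2) * (stdTriple₃ (i + 1))ᴴ =
      (-1 / 2 : ℂ) • irrep 5 i := by
  simp only [conjTranspose_stdTriple₃]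
  ext a b
  obtain rfl | rfl | rfl := Fin.eq_zero_or_one_or_two i <;> simp only [Fin.reduceAdd, zero_add] <;>
    simp <;> fin_cases a <;> fin_cases b <;> simp <;>
    grind [rootTwo_sq, rootThree_sq, Complex.I_sq]

theorem stdTriple₁_commutator (i : Fin 3) :
    stdTriple₁ (i + 1) * (stdTriple₁ (i + 2))ᴴ - stdTriple₁ (i + 2) * (stdTriple₁ (i + 1))ᴴ =
      -irrep 3 i := by
  simp only [conjTranspose_stdTriple₁]
  ext a b
  obtain rfl | rfl | rfl := Fin.eq_zero_or_one_or_two i <;> simp only [Fin.reduceAdd, zero_add] <;>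
    simp <;> fin_cases a <;> fin_cases b <;> simp <;>
    grind [rootTwo_sq, rootThree_sq, Complex.I_sq]

theorem sum_irrep_three_mul_self : ∑ k, irrep 3 k * irrep 3 k = (-2 : ℂ) • 1 := by
  ext a b
  simp
  fin_cases a <;> fin_cases b <;> simp <;> grind [rootTwo_sq, rootThree_sq, Complex.I_sq]

set_option maxHeartbeats 1000000 in
theorem sum_irrep_five_mul_self : ∑ k, irrep 5 k * irrep 5 k = (-6 : ℂ) • 1 := by
  ext a b
  simp
  fin_cases a <;> fin_cases b <;> simp <;> grind [rootTwo_sq, rootThree_sq, Complex.I_sq]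

end Tables

/-! ### Schur's lemma for equivariant triples -/

theorem irrep_two (m : ℕ) : irrep m 2 =
    (-Complex.I) • Matrix.diagonal fun a : Fin m => ((m : ℂ) - 1) / 2 - ((a : ℕ) : ℂ) := rfl

/-- An equivariant triple of linear maps `V_n → V_m`: an element of the invariant part of
`V_m ⊗ V_n^* ⊗ V_3`. -/
def IsEquivariantTriple {m n : ℕ} (C : Fin 3 → Matrix (Fin m) (Fin n) ℂ) : Prop :=
  ∀ j k, irrep m j * C k - C k * irrep n j = ∑ i, leviCivita j k i • C i

namespace IsEquivariantTriple

variable {m n : ℕ} {C D : Fin 3 → Matrix (Fin m) (Fin n) ℂ}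

theorem apply_zero (hC : IsEquivariantTriple C) : C 0 = irrep m 1 * C 2 - C 2 * irrep n 1 := by
  rw [hC 1 2]; simp [leviCivita]

theorem apply_one (hC : IsEquivariantTriple C) : C 1 = -(irrep m 0 * C 2 - C 2 * irrep n 0) := by
  rw [hC 0 2]; simp [leviCivita]

/-- An equivariant triple is determined by its component along the weight operator. -/
theorem eq_smul (hC : IsEquivariantTriple C) (hD : IsEquivariantTriple D) {c : ℂ}
    (h : C 2 = c • D 2) (i : Fin 3) : C i = c • D i := by
  fin_cases i
  · change C 0 = c • D 0
    rw [hC.apply_zero, hD.apply_zero, h, Matrix.mul_smul, Matrix.smul_mul, smul_sub]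
  · change C 1 = c • D 1
    rw [hC.apply_one, hD.apply_one, h, Matrix.mul_smul, Matrix.smul_mul, smul_neg, smul_sub]
  · exact h

/-- The third component preserves weights. -/
theorem apply_two_eq_zero (hC : IsEquivariantTriple C) {a : Fin m} {b : Fin n}
    (hab : ((m : ℂ) - 1) / 2 - ((a : ℕ) : ℂ) ≠ ((n : ℂ) - 1) / 2 - ((b : ℕ) : ℂ)) :
    C 2 a b = 0 := by
  have h : irrep m 2 * C 2 - C 2 * irrep n 2 = 0 := by
    rw [hC 2 2]; simp [leviCivita]
  have h' := congrFun (congrFun h a) b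
  rw [irrep_two, irrep_two] at h'
  simp only [Matrix.smul_mul, Matrix.mul_smul, Matrix.sub_apply, Matrix.smul_apply, diagonal_mul,
    mul_diagonal, smul_eq_mul] at h'
  have h'' : (((m : ℂ) - 1) / 2 - ((a : ℕ) : ℂ) - (((n : ℂ) - 1) / 2 - ((b : ℕ) : ℂ))) * C 2 a b
      = 0 := by
    rw [Matrix.zero_apply] at h'
    linear_combination Complex.I * h' + ((((m : ℂ) - 1) / 2 - ((a : ℕ) : ℂ) -
      (((n : ℂ) - 1) / 2 - ((b : ℕ) : ℂ))) * C 2 a b) * (Complex.I_sq)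
  exact (mul_eq_zero.1 h'').resolve_left (sub_ne_zero.2 hab)

/-- The Casimir-type relation that gives a three-term recurrence for the entries of `C 2`. -/
theorem double_commutator (hC : IsEquivariantTriple C) :
    irrep m 0 * (irrep m 0 * C 2 - C 2 * irrep n 0) -
      (irrep m 0 * C 2 - C 2 * irrep n 0) * irrep n 0 = -C 2 := by
  have h : irrep m 0 * C 1 - C 1 * irrep n 0 = C 2 := by
    rw [hC 0 1]; simp [leviCivita]
  rw [hC.apply_one] at h
  rw [← neg_inj, neg_neg]
  conv_rhs => rw [← h]
  simp only [Matrix.mul_neg, Matrix.neg_mul]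
  abel

end IsEquivariantTriple

/-- The recurrence determines `C 2` by its first entry. -/
theorem IsEquivariantTriple.eq_smul_stdTriple₃ {C : Fin 3 → Matrix (Fin 5) (Fin 3) ℂ}
    (hC : IsEquivariantTriple C) : C 2 = (rootTwo * C 2 1 0) • stdTriple₃ 2 := by
  have h2 := rootTwo_sq
  have h3 := rootThree_sq
  have hI := Complex.I_sq
  obtain ⟨x, hx⟩ : ∃ x, x = C 2 1 0 := ⟨_, rfl⟩
  obtain ⟨y, hy⟩ : ∃ y, y = C 2 2 1 := ⟨_, rfl⟩
  obtain ⟨z, hz⟩ : ∃ z, z = C 2 3 2 := ⟨_, rfl⟩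
  have hC2 : C 2 = !![0, 0, 0; x, 0, 0; 0, y, 0; 0, 0, z; 0, 0, 0] := by
    ext a b
    fin_cases a <;> fin_cases b <;> simp [hx, hy, hz] <;> apply hC.apply_two_eq_zero <;> norm_num
  have h := hC.double_commutator
  rw [hC2] at h
  have h10 := congrFun (congrFun h 1) 0
  have h21 := congrFun (congrFun h 2) 1
  simp [irrep_five_zero, irrep_three_zero] at h10 h21
  rw [← hx, hC2]
  ext a b
  fin_cases a <;> fin_cases b <;> simp [stdTriple₃] <;> grind

theorem IsEquivariantTriple.eq_smul_stdTriple₁ {C : Fin 3 → Matrix (Fin 3) (Fin 1) ℂ}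
    (hC : IsEquivariantTriple C) : C 2 = C 2 1 0 • stdTriple₁ 2 := by
  ext a b
  fin_cases a <;> fin_cases b <;> simp [stdTriple₁] <;> apply hC.apply_two_eq_zero <;> norm_num

theorem IsEquivariantTriple.eq_smul_irrep_five {C : Fin 3 → Matrix (Fin 5) (Fin 5) ℂ}
    (hC : IsEquivariantTriple C) : C 2 = (Complex.I / 2 * C 2 0 0) • irrep 5 2 := by
  have h2 := rootTwo_sq
  have h3 := rootThree_sq
  have hI := Complex.I_sq
  obtain ⟨x, hx⟩ : ∃ x, x = C 2 0 0 := ⟨_, rfl⟩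
  obtain ⟨y, hy⟩ : ∃ y, y = C 2 1 1 := ⟨_, rfl⟩
  obtain ⟨z, hz⟩ : ∃ z, z = C 2 2 2 := ⟨_, rfl⟩
  obtain ⟨u, hu⟩ : ∃ u, u = C 2 3 3 := ⟨_, rfl⟩
  obtain ⟨v, hv⟩ : ∃ v, v = C 2 4 4 := ⟨_, rfl⟩
  have hC2 : C 2 = !![x, 0, 0, 0, 0; 0, y, 0, 0, 0; 0, 0, z, 0, 0; 0, 0, 0, u, 0;
      0, 0, 0, 0, v] := by
    ext a b
    fin_cases a <;> fin_cases b <;> simp [hx, hy, hz, hu, hv] <;>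
      apply hC.apply_two_eq_zero <;> norm_num
  have h := hC.double_commutator
  rw [hC2] at h
  have h0 := congrFun (congrFun h 0) 0
  have h1 := congrFun (congrFun h 1) 1
  have h2' := congrFun (congrFun h 2) 2
  have h3' := congrFun (congrFun h 3) 3
  simp [irrep_five_zero] at h0 h1 h2' h3'
  rw [← hx, hC2]
  ext a b
  fin_cases a <;> fin_cases b <;> simp [irrep_five_two] <;> grind

theorem IsEquivariantTriple.eq_smul_irrep_three {C : Fin 3 → Matrix (Fin 3) (Fin 3) ℂ}
    (hC : IsEquivariantTriple C) : C 2 = (Complex.I * C 2 0 0) • irrep 3 2 := by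
  have h2 := rootTwo_sq
  have hI := Complex.I_sq
  obtain ⟨x, hx⟩ : ∃ x, x = C 2 0 0 := ⟨_, rfl⟩
  obtain ⟨y, hy⟩ : ∃ y, y = C 2 1 1 := ⟨_, rfl⟩
  obtain ⟨z, hz⟩ : ∃ z, z = C 2 2 2 := ⟨_, rfl⟩
  have hC2 : C 2 = !![x, 0, 0; 0, y, 0; 0, 0, z] := by
    ext a b
    fin_cases a <;> fin_cases b <;> simp [hx, hy, hz] <;> apply hC.apply_two_eq_zero <;> norm_num
  have h := hC.double_commutator
  rw [hC2] at h
  have h0 := congrFun (congrFun h 0) 0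
  have h1 := congrFun (congrFun h 1) 1
  simp [irrep_three_zero] at h0 h1
  rw [← hx, hC2]
  ext a b
  fin_cases a <;> fin_cases b <;> simp [irrep_three_two] <;> grind

theorem IsEquivariantTriple.five_one_eq_zero {C : Fin 3 → Matrix (Fin 5) (Fin 1) ℂ}
    (hC : IsEquivariantTriple C) (i : Fin 3) : C i = 0 := by
  have h2 := rootTwo_sq
  have h3 := rootThree_sq
  have hI := Complex.I_sq
  obtain ⟨x, hx⟩ : ∃ x, x = C 2 2 0 := ⟨_, rfl⟩
  have hC2 : C 2 = !![0; 0; x; 0; 0] := by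
    ext a b
    fin_cases a <;> fin_cases b <;> simp [hx] <;> apply hC.apply_two_eq_zero <;> norm_num
  have h := hC.double_commutator
  rw [hC2] at h
  have h20 := congrFun (congrFun h 2) 0
  simp [irrep_five_zero, irrep_one] at h20
  have hx0 : x = 0 := by grind
  have h0 : C 2 = (0 : ℂ) • C 2 := by
    rw [zero_smul, hC2, hx0]
    ext a b
    fin_cases a <;> fin_cases b <;> rfl
  rw [hC.eq_smul hC h0 i, zero_smul]

theorem IsEquivariantTriple.one_one_eq_zero {C : Fin 3 → Matrix (Fin 1) (Fin 1) ℂ}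
    (hC : IsEquivariantTriple C) (i : Fin 3) : C i = 0 := by
  have h := hC.double_commutator
  have h0 : C 2 = (0 : ℂ) • C 2 := by
    rw [zero_smul, ← neg_eq_zero, ← h]
    simp [irrep_one]
  rw [hC.eq_smul hC h0 i, zero_smul]

/-! ### Identities for arbitrary invariant triples -/

theorem sum_leviCivita_succ {M : Type*} [AddCommGroup M] [Module ℂ M] (Y : Fin 3 → M) (i : Fin 3) :
    ∑ k, leviCivita (i + 1) (i + 2) k • Y k = Y i := by
  fin_cases i <;> simp [leviCivita]

theorem sum_leviCivita_succ' {M : Type*} [AddCommGroup M] [Module ℂ M] (Y : Fin 3 → M)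
    (i : Fin 3) : ∑ k, leviCivita (i + 2) (i + 1) k • Y k = -Y i := by
  fin_cases i <;> simp [leviCivita]

theorem IsSO3Rep.commutator {n : Type*} [Fintype n] {Y : Fin 3 → Matrix n n ℂ} (h : IsSO3Rep Y)
    (i : Fin 3) : Y (i + 1) * Y (i + 2) - Y (i + 2) * Y (i + 1) = Y i := by
  rw [h, sum_leviCivita_succ]

theorem isInvariantTriple_stdTriple₃ : IsInvariantTriple 3 stdTriple₃ :=
  ⟨stdTriple₃_equivariant, sum_stdTriple₃_mul_conjTranspose⟩

theorem isInvariantTriple_stdTriple₁ : IsInvariantTriple 1 stdTriple₁ :=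
  ⟨stdTriple₁_equivariant, sum_stdTriple₁_mul_conjTranspose⟩

theorem star_mul_self_eq_one_of_smul {m n : Type*} [Fintype m] [Fintype n] [DecidableEq m]
    [Nonempty m] {B D : Fin 3 → Matrix m n ℂ} {u : ℂ} (hB : ∑ i, B i * (B i)ᴴ = 1)
    (hD : ∑ i, D i * (D i)ᴴ = 1) (h : ∀ i, B i = u • D i) : star u * u = 1 := by
  have h1 : (1 : Matrix m m ℂ) = (star u * u) • 1 := by
    conv_lhs => rw [← hB]
    conv_rhs => rw [← hD]
    simp only [h, conjTranspose_smul, Matrix.smul_mul, Matrix.mul_smul, smul_smul,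
      Finset.smul_sum, mul_comm]
  obtain ⟨a⟩ := ‹Nonempty m›
  have := congrFun (congrFun h1 a) a
  simpa using this.symm

theorem IsInvariantTriple.exists_eq_smul_stdTriple₃ {B : Fin 3 → Matrix (Fin 5) (Fin 3) ℂ}
    (hB : IsInvariantTriple 3 B) : ∃ u : ℂ, star u * u = 1 ∧ ∀ i, B i = u • stdTriple₃ i := by
  have h : ∀ i, B i = (rootTwo * B 2 1 0) • stdTriple₃ i := fun i =>
    IsEquivariantTriple.eq_smul (C := B) hB.1 stdTriple₃_equivariant
      (IsEquivariantTriple.eq_smul_stdTriple₃ hB.1) i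
  exact ⟨_, star_mul_self_eq_one_of_smul hB.2 sum_stdTriple₃_mul_conjTranspose h, h⟩

theorem IsInvariantTriple.exists_eq_smul_stdTriple₁ {B : Fin 3 → Matrix (Fin 3) (Fin 1) ℂ}
    (hB : IsInvariantTriple 1 B) : ∃ u : ℂ, star u * u = 1 ∧ ∀ i, B i = u • stdTriple₁ i := by
  have h : ∀ i, B i = (B 2 1 0) • stdTriple₁ i := fun i =>
    IsEquivariantTriple.eq_smul (C := B) hB.1 stdTriple₁_equivariant
      (IsEquivariantTriple.eq_smul_stdTriple₁ hB.1) i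
  exact ⟨_, star_mul_self_eq_one_of_smul hB.2 sum_stdTriple₁_mul_conjTranspose h, h⟩

section InvariantTriples

variable {B₃ : Fin 3 → Matrix (Fin 5) (Fin 3) ℂ} {B₁ : Fin 3 → Matrix (Fin 3) (Fin 1) ℂ}

theorem IsInvariantTriple.apply_two_one_zero_ne_zero₃ (h₃ : IsInvariantTriple 3 B₃) :
    B₃ 2 1 0 ≠ 0 := by
  obtain ⟨u, hu, hB⟩ := h₃.exists_eq_smul_stdTriple₃
  have hu0 : u ≠ 0 := by rintro rfl; simp at hu
  have h2 : rootTwo ≠ 0 := by intro h; simpa [h] using rootTwo_sq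
  rw [hB]
  simp [stdTriple₃, hu0, h2]

theorem IsInvariantTriple.apply_two_one_zero_ne_zero₁ (h₁ : IsInvariantTriple 1 B₁) :
    B₁ 2 1 0 ≠ 0 := by
  obtain ⟨u, hu, hB⟩ := h₁.exists_eq_smul_stdTriple₁
  have hu0 : u ≠ 0 := by rintro rfl; simp at hu
  rw [hB]
  simp [stdTriple₁, hu0]

theorem IsInvariantTriple.mul_irrep (h₃ : IsInvariantTriple 3 B₃) (i k : Fin 3) :
    B₃ k * irrep 3 i =
      (1 / 2 : ℂ) • (irrep 5 i * B₃ k) + (1 / 2 : ℂ) • (B₃ i * irrep 3 k) := by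
  obtain ⟨u, hu, hB⟩ := h₃.exists_eq_smul_stdTriple₃
  simp only [hB, Matrix.smul_mul, Matrix.mul_smul]
  rw [stdTriple₃_mul_irrep, smul_add, smul_comm u, smul_comm u]

theorem IsInvariantTriple.irrep_mul_irrep (h₃ : IsInvariantTriple 3 B₃)
    (h₁ : IsInvariantTriple 1 B₁) (i k : Fin 3) :
    irrep 3 k * irrep 3 i = (1 / 2 : ℂ) • (irrep 3 i * irrep 3 k) -
      (B₃ i)ᴴ * B₃ k + (2 / 3 : ℂ) • (B₁ i * (B₁ k)ᴴ) := by
  obtain ⟨u, hu, hB⟩ := h₃.exists_eq_smul_stdTriple₃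
  obtain ⟨v, hv, hD⟩ := h₁.exists_eq_smul_stdTriple₁
  simp only [hB, hD, conjTranspose_smul, Matrix.smul_mul, Matrix.mul_smul, smul_smul, hu, hv,
    mul_comm _ (star _), one_smul]
  exact irrep_three_mul_irrep_three i k

theorem IsInvariantTriple.sum_mul_irrep (h₃ : IsInvariantTriple 3 B₃) :
    ∑ k, B₃ k * irrep 3 k = 0 := by
  obtain ⟨u, hu, hB⟩ := h₃.exists_eq_smul_stdTriple₃
  simp only [hB, Matrix.smul_mul, ← Finset.smul_sum, sum_stdTriple₃_mul_irrep, smul_zero]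

theorem IsInvariantTriple.sum_mul (h₃ : IsInvariantTriple 3 B₃) (h₁ : IsInvariantTriple 1 B₁) :
    ∑ k, B₃ k * B₁ k = 0 := by
  obtain ⟨u, hu, hB⟩ := h₃.exists_eq_smul_stdTriple₃
  obtain ⟨v, hv, hD⟩ := h₁.exists_eq_smul_stdTriple₁
  simp only [hB, hD, Matrix.smul_mul, Matrix.mul_smul, ← Finset.smul_sum,
    sum_stdTriple₃_mul_stdTriple₁, smul_zero]

theorem IsInvariantTriple.mul_comm (h₃ : IsInvariantTriple 3 B₃) (h₁ : IsInvariantTriple 1 B₁)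
    (i k : Fin 3) : B₃ i * B₁ k = B₃ k * B₁ i := by
  obtain ⟨u, hu, hB⟩ := h₃.exists_eq_smul_stdTriple₃
  obtain ⟨v, hv, hD⟩ := h₁.exists_eq_smul_stdTriple₁
  simp only [hB, hD, Matrix.smul_mul, Matrix.mul_smul, stdTriple₃_mul_stdTriple₁_comm i k]

theorem IsInvariantTriple.sum_conjTranspose_mul (h₁ : IsInvariantTriple 1 B₁) :
    ∑ k, (B₁ k)ᴴ * B₁ k = (3 : ℂ) • 1 := by
  obtain ⟨v, hv, hD⟩ := h₁.exists_eq_smul_stdTriple₁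
  simp only [hD, conjTranspose_smul, Matrix.smul_mul, Matrix.mul_smul, smul_smul, hv,
    _root_.mul_comm _ (star _), one_smul]
  exact sum_conjTranspose_stdTriple₁_mul

theorem IsInvariantTriple.commutator₃ (h₃ : IsInvariantTriple 3 B₃) (i : Fin 3) :
    B₃ (i + 1) * (B₃ (i + 2))ᴴ - B₃ (i + 2) * (B₃ (i + 1))ᴴ = (-1 / 2 : ℂ) • irrep 5 i := by
  obtain ⟨u, hu, hB⟩ := h₃.exists_eq_smul_stdTriple₃
  simp only [hB, conjTranspose_smul, Matrix.smul_mul, Matrix.mul_smul, smul_smul, hu,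
    one_smul]
  exact stdTriple₃_commutator i

theorem IsInvariantTriple.commutator₁ (h₁ : IsInvariantTriple 1 B₁) (i : Fin 3) :
    B₁ (i + 1) * (B₁ (i + 2))ᴴ - B₁ (i + 2) * (B₁ (i + 1))ᴴ = -irrep 3 i := by
  obtain ⟨v, hv, hD⟩ := h₁.exists_eq_smul_stdTriple₁
  simp only [hD, conjTranspose_smul, Matrix.smul_mul, Matrix.mul_smul, smul_smul, hv,
    one_smul]
  exact stdTriple₁_commutator i

theorem IsInvariantTriple.conjTranspose_commutator (h₃ : IsInvariantTriple 3 B₃) (i : Fin 3) :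
    (B₃ (i + 1))ᴴ * B₃ (i + 2) - (B₃ (i + 2))ᴴ * B₃ (i + 1) = (5 / 6 : ℂ) • irrep 3 i := by
  have h₁ := isInvariantTriple_stdTriple₁
  have e1 := h₃.irrep_mul_irrep h₁ (i + 1) (i + 2)
  have e2 := h₃.irrep_mul_irrep h₁ (i + 2) (i + 1)
  have e3 := h₁.commutator₁ i
  have e4 := isSO3Rep_irrep_three.commutator i
  linear_combination (norm := module) e1 - e2 + (2 / 3 : ℂ) • e3 + (3 / 2 : ℂ) • e4

/-- The part of `[A_{i+1}, A_{i+2}]` mapping `V₃` to `V₅` and coming from `ρ₅`. -/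
theorem IsInvariantTriple.irrep_mul_sub (h₃ : IsInvariantTriple 3 B₃) (i : Fin 3) :
    irrep 5 (i + 1) * B₃ (i + 2) - irrep 5 (i + 2) * B₃ (i + 1) = (3 : ℂ) • B₃ i := by
  have e1 : irrep 5 (i + 1) * B₃ (i + 2) - B₃ (i + 2) * irrep 3 (i + 1) = B₃ i :=
    (h₃.1 (i + 1) (i + 2)).trans (sum_leviCivita_succ _ _)
  have e2 : irrep 5 (i + 2) * B₃ (i + 1) - B₃ (i + 1) * irrep 3 (i + 2) = -B₃ i :=
    (h₃.1 (i + 2) (i + 1)).trans (sum_leviCivita_succ' _ _)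
  have e3 := h₃.mul_irrep (i + 1) (i + 2)
  have e4 := h₃.mul_irrep (i + 2) (i + 1)
  linear_combination (norm := module) (3 / 2 : ℂ) • e1 - (3 / 2 : ℂ) • e2 + e3 - e4

theorem IsInvariantTriple.mul_irrep_sub (h₃ : IsInvariantTriple 3 B₃) (i : Fin 3) :
    B₃ (i + 1) * irrep 3 (i + 2) - B₃ (i + 2) * irrep 3 (i + 1) = -B₃ i := by
  have e1 : irrep 5 (i + 1) * B₃ (i + 2) - B₃ (i + 2) * irrep 3 (i + 1) = B₃ i :=
    (h₃.1 (i + 1) (i + 2)).trans (sum_leviCivita_succ _ _)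
  have e2 : irrep 5 (i + 2) * B₃ (i + 1) - B₃ (i + 1) * irrep 3 (i + 2) = -B₃ i :=
    (h₃.1 (i + 2) (i + 1)).trans (sum_leviCivita_succ' _ _)
  linear_combination (norm := module) e1 - e2 - h₃.irrep_mul_sub i

theorem IsInvariantTriple.irrep_three_mul (h₁ : IsInvariantTriple 1 B₁) (j k : Fin 3) :
    irrep 3 j * B₁ k = ∑ i, leviCivita j k i • B₁ i := by
  have h := h₁.1 j k
  rw [irrep_one, Matrix.mul_zero, sub_zero] at h
  exact h

theorem IsInvariantTriple.irrep_three_mul_swap (h₁ : IsInvariantTriple 1 B₁) (j k : Fin 3) :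
    irrep 3 j * B₁ k = -(irrep 3 k * B₁ j) := by
  rw [h₁.irrep_three_mul, h₁.irrep_three_mul, ← Finset.sum_neg_distrib]
  refine Finset.sum_congr rfl fun i _ => ?_
  rw [← neg_smul]
  congr 1
  fin_cases j <;> fin_cases k <;> fin_cases i <;> simp [leviCivita]

theorem IsInvariantTriple.irrep_three_mul_sub (h₁ : IsInvariantTriple 1 B₁) (i : Fin 3) :
    irrep 3 (i + 1) * B₁ (i + 2) - irrep 3 (i + 2) * B₁ (i + 1) = (2 : ℂ) • B₁ i := by
  rw [h₁.irrep_three_mul, h₁.irrep_three_mul, sum_leviCivita_succ, sum_leviCivita_succ', two_smul,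
    sub_neg_eq_add]

end InvariantTriples

section irrep

theorem conjTranspose_irrep (m : ℕ) (i : Fin 3) : (irrep m i)ᴴ = -irrep m i := by
  obtain rfl | rfl | rfl := Fin.eq_zero_or_one_or_two i
  · ext a b
    rw [conjTranspose_apply, Matrix.neg_apply, irrep_zero_apply, irrep_zero_apply]
    simp
    ring
  · ext a b
    rw [conjTranspose_apply, Matrix.neg_apply, irrep_one_apply, irrep_one_apply]
    simp
    ring
  · rw [irrep_two, conjTranspose_smul, diagonal_conjTranspose, ← neg_smul]
    congr 1
    · simp
    · congr 1
      ext a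
      simp

theorem trace_irrep_five (i : Fin 3) : (irrep 5 i).trace = 0 := by
  obtain rfl | rfl | rfl := Fin.eq_zero_or_one_or_two i <;>
    simp [Matrix.trace, Fin.sum_univ_five, irrep_five_zero, irrep_five_one, irrep_five_two]

theorem trace_irrep_three (i : Fin 3) : (irrep 3 i).trace = 0 := by
  obtain rfl | rfl | rfl := Fin.eq_zero_or_one_or_two i <;>
    simp [Matrix.trace, Fin.sum_univ_three, irrep_three_zero, irrep_three_one, irrep_three_two]

end irrep

/-! ### The block tridiagonal ansatz -/

section Blocks

variable {l m n : Type*}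

/-- The `3 × 3` block matrix with the given blocks. -/
def blockMatrix (A₁₁ : Matrix l l ℂ) (A₁₂ : Matrix l m ℂ) (A₁₃ : Matrix l n ℂ)
    (A₂₁ : Matrix m l ℂ) (A₂₂ : Matrix m m ℂ) (A₂₃ : Matrix m n ℂ)
    (A₃₁ : Matrix n l ℂ) (A₃₂ : Matrix n m ℂ) (A₃₃ : Matrix n n ℂ) :
    Matrix (l ⊕ m ⊕ n) (l ⊕ m ⊕ n) ℂ :=
  fromBlocks A₁₁ (fromCols A₁₂ A₁₃) (fromRows A₂₁ A₃₁) (fromBlocks A₂₂ A₂₃ A₃₂ A₃₃)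

variable {A₁₁ B₁₁ : Matrix l l ℂ} {A₁₂ B₁₂ : Matrix l m ℂ} {A₁₃ B₁₃ : Matrix l n ℂ}
  {A₂₁ B₂₁ : Matrix m l ℂ} {A₂₂ B₂₂ : Matrix m m ℂ} {A₂₃ B₂₃ : Matrix m n ℂ}
  {A₃₁ B₃₁ : Matrix n l ℂ} {A₃₂ B₃₂ : Matrix n m ℂ} {A₃₃ B₃₃ : Matrix n n ℂ}

theorem blockMatrix_sub :
    blockMatrix A₁₁ A₁₂ A₁₃ A₂₁ A₂₂ A₂₃ A₃₁ A₃₂ A₃₃ -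
      blockMatrix B₁₁ B₁₂ B₁₃ B₂₁ B₂₂ B₂₃ B₃₁ B₃₂ B₃₃ =
    blockMatrix (A₁₁ - B₁₁) (A₁₂ - B₁₂) (A₁₃ - B₁₃) (A₂₁ - B₂₁) (A₂₂ - B₂₂) (A₂₃ - B₂₃)
      (A₃₁ - B₃₁) (A₃₂ - B₃₂) (A₃₃ - B₃₃) := by
  ext (a | a | a) (b | b | b) <;> rfl

theorem blockMatrix_add :
    blockMatrix A₁₁ A₁₂ A₁₃ A₂₁ A₂₂ A₂₃ A₃₁ A₃₂ A₃₃ +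
      blockMatrix B₁₁ B₁₂ B₁₃ B₂₁ B₂₂ B₂₃ B₃₁ B₃₂ B₃₃ =
    blockMatrix (A₁₁ + B₁₁) (A₁₂ + B₁₂) (A₁₃ + B₁₃) (A₂₁ + B₂₁) (A₂₂ + B₂₂) (A₂₃ + B₂₃)
      (A₃₁ + B₃₁) (A₃₂ + B₃₂) (A₃₃ + B₃₃) := by
  ext (a | a | a) (b | b | b) <;> rfl

theorem blockMatrix_neg :
    -blockMatrix A₁₁ A₁₂ A₁₃ A₂₁ A₂₂ A₂₃ A₃₁ A₃₂ A₃₃ =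
    blockMatrix (-A₁₁) (-A₁₂) (-A₁₃) (-A₂₁) (-A₂₂) (-A₂₃) (-A₃₁) (-A₃₂) (-A₃₃) := by
  ext (a | a | a) (b | b | b) <;> rfl

theorem blockMatrix_smul (c : ℂ) :
    c • blockMatrix A₁₁ A₁₂ A₁₃ A₂₁ A₂₂ A₂₃ A₃₁ A₃₂ A₃₃ =
    blockMatrix (c • A₁₁) (c • A₁₂) (c • A₁₃) (c • A₂₁) (c • A₂₂) (c • A₂₃) (c • A₃₁) (c • A₃₂)
      (c • A₃₃) := by
  ext (a | a | a) (b | b | b) <;> rfl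

theorem blockMatrix_conjTranspose :
    (blockMatrix A₁₁ A₁₂ A₁₃ A₂₁ A₂₂ A₂₃ A₃₁ A₃₂ A₃₃)ᴴ =
    blockMatrix A₁₁ᴴ A₂₁ᴴ A₃₁ᴴ A₁₂ᴴ A₂₂ᴴ A₃₂ᴴ A₁₃ᴴ A₂₃ᴴ A₃₃ᴴ := by
  ext (a | a | a) (b | b | b) <;> rfl

theorem blockMatrix_inj :
    blockMatrix A₁₁ A₁₂ A₁₃ A₂₁ A₂₂ A₂₃ A₃₁ A₃₂ A₃₃ =
      blockMatrix B₁₁ B₁₂ B₁₃ B₂₁ B₂₂ B₂₃ B₃₁ B₃₂ B₃₃ ↔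
    (A₁₁ = B₁₁ ∧ A₁₂ = B₁₂ ∧ A₁₃ = B₁₃) ∧ (A₂₁ = B₂₁ ∧ A₂₂ = B₂₂ ∧ A₂₃ = B₂₃) ∧
      (A₃₁ = B₃₁ ∧ A₃₂ = B₃₂ ∧ A₃₃ = B₃₃) := by
  refine ⟨fun h => ?_, ?_⟩
  · have h' := fun a b => congrFun (congrFun h a) b
    exact ⟨⟨ext fun a b => h' (.inl a) (.inl b), ext fun a b => h' (.inl a) (.inr (.inl b)),
        ext fun a b => h' (.inl a) (.inr (.inr b))⟩,
      ⟨ext fun a b => h' (.inr (.inl a)) (.inl b), ext fun a b => h' (.inr (.inl a)) (.inr (.inl b)),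
        ext fun a b => h' (.inr (.inl a)) (.inr (.inr b))⟩,
      ⟨ext fun a b => h' (.inr (.inr a)) (.inl b), ext fun a b => h' (.inr (.inr a)) (.inr (.inl b)),
        ext fun a b => h' (.inr (.inr a)) (.inr (.inr b))⟩⟩
  · rintro ⟨⟨rfl, rfl, rfl⟩, ⟨rfl, rfl, rfl⟩, rfl, rfl, rfl⟩
    rfl

theorem blockMatrix_one [DecidableEq l] [DecidableEq m] [DecidableEq n] :
    blockMatrix (1 : Matrix l l ℂ) 0 0 0 (1 : Matrix m m ℂ) 0 0 0 (1 : Matrix n n ℂ) = 1 := by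
  ext (a | a | a) (b | b | b) <;> simp [blockMatrix, one_apply]

variable [Fintype l] [Fintype m] [Fintype n]

theorem blockMatrix_mul :
    blockMatrix A₁₁ A₁₂ A₁₃ A₂₁ A₂₂ A₂₃ A₃₁ A₃₂ A₃₃ *
      blockMatrix B₁₁ B₁₂ B₁₃ B₂₁ B₂₂ B₂₃ B₃₁ B₃₂ B₃₃ =
    blockMatrix (A₁₁ * B₁₁ + A₁₂ * B₂₁ + A₁₃ * B₃₁) (A₁₁ * B₁₂ + A₁₂ * B₂₂ + A₁₃ * B₃₂)
      (A₁₁ * B₁₃ + A₁₂ * B₂₃ + A₁₃ * B₃₃)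
      (A₂₁ * B₁₁ + A₂₂ * B₂₁ + A₂₃ * B₃₁) (A₂₁ * B₁₂ + A₂₂ * B₂₂ + A₂₃ * B₃₂)
      (A₂₁ * B₁₃ + A₂₂ * B₂₃ + A₂₃ * B₃₃)
      (A₃₁ * B₁₁ + A₃₂ * B₂₁ + A₃₃ * B₃₁) (A₃₁ * B₁₂ + A₃₂ * B₂₂ + A₃₃ * B₃₂)
      (A₃₁ * B₁₃ + A₃₂ * B₂₃ + A₃₃ * B₃₃) := by
  ext (a | a | a) (b | b | b) <;>
    simp [blockMatrix, mul_apply, Fintype.sum_sum_type, add_assoc]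

theorem blockMatrix_trace :
    (blockMatrix A₁₁ A₁₂ A₁₃ A₂₁ A₂₂ A₂₃ A₃₁ A₃₂ A₃₃).trace =
      A₁₁.trace + A₂₂.trace + A₃₃.trace := by
  simp [blockMatrix, Matrix.trace, Fintype.sum_sum_type, add_assoc]

end Blocks

theorem rep531_eq_blockMatrix (i : Fin 3) :
    rep531 i = blockMatrix (irrep 5 i) 0 0 0 (irrep 3 i) 0 0 0 0 := by
  rw [rep531, irrep_one]
  ext (a | a | a) (b | b | b) <;> rfl

/-- The block tridiagonal matrix `ansatz531` with complex off-diagonal coefficients. -/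
noncomputable def complexAnsatz (B₃ : Fin 3 → Matrix (Fin 5) (Fin 3) ℂ)
    (B₁ : Fin 3 → Matrix (Fin 3) (Fin 1) ℂ) (f₁ f₂ : ℝ) (g₀ g₁ : ℂ) (i : Fin 3) :
    Matrix Idx531 Idx531 ℂ :=
  blockMatrix ((f₂ : ℂ) • irrep 5 i) (g₁ • B₃ i) 0 (-(star g₁ • (B₃ i)ᴴ)) ((f₁ : ℂ) • irrep 3 i)
    (g₀ • B₁ i) 0 (-(star g₀ • (B₁ i)ᴴ)) 0

theorem ansatz531_eq_complexAnsatz (B₃ : Fin 3 → Matrix (Fin 5) (Fin 3) ℂ)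
    (B₁ : Fin 3 → Matrix (Fin 3) (Fin 1) ℂ) (f₁ f₂ g₀ g₁ : ℝ) (i : Fin 3) :
    ansatz531 B₃ B₁ f₁ f₂ g₀ g₁ i = complexAnsatz B₃ B₁ f₁ f₂ g₀ g₁ i := by
  simp only [complexAnsatz, RCLike.star_def, Complex.conj_ofReal]
  ext (a | a | a) (b | b | b) <;> rfl

section Ansatz

variable {B₃ : Fin 3 → Matrix (Fin 5) (Fin 3) ℂ} {B₁ : Fin 3 → Matrix (Fin 3) (Fin 1) ℂ}

theorem IsInvariantTriple.conjTranspose_mul_eq_zero (h₁ : IsInvariantTriple 1 B₁) (i : Fin 3) :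
    (B₁ (i + 1))ᴴ * B₁ (i + 2) = 0 := by
  have h : B₁ (i + 1) = irrep 3 (i + 2) * B₁ i := by
    have := h₁.irrep_three_mul (i + 1 + 1) (i + 1 + 2)
    rw [sum_leviCivita_succ, add_assoc, add_assoc] at this
    simpa using this.symm
  have h' : irrep 3 (i + 2) * B₁ (i + 2) = 0 := by
    have := h₁.irrep_three_mul_swap (i + 2) (i + 2)
    ext a b
    exact self_eq_neg.1 (congrFun (congrFun this a) b)
  rw [h, conjTranspose_mul, Matrix.mul_assoc, conjTranspose_irrep, Matrix.neg_mul, h', neg_zero,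
    Matrix.mul_zero]

/-- The ansatz reduces Nahm's equations to the system for the coefficients. -/
theorem complexAnsatz_commutator (h₃ : IsInvariantTriple 3 B₃) (h₁ : IsInvariantTriple 1 B₁)
    (f₁ f₂ : ℝ) (g₀ g₁ : ℂ) (i : Fin 3) :
    complexAnsatz B₃ B₁ f₁ f₂ g₀ g₁ (i + 1) * complexAnsatz B₃ B₁ f₁ f₂ g₀ g₁ (i + 2) -
      complexAnsatz B₃ B₁ f₁ f₂ g₀ g₁ (i + 2) * complexAnsatz B₃ B₁ f₁ f₂ g₀ g₁ (i + 1) =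
    complexAnsatz B₃ B₁ (f₁ ^ 2 + Complex.normSq g₀ - 5 / 6 * Complex.normSq g₁)
      (f₂ ^ 2 + 1 / 2 * Complex.normSq g₁) (2 * f₁ * g₀) ((3 * f₂ - f₁) * g₁) i := by
  have a5 := isSO3Rep_irrep_five.commutator i
  have a3 := isSO3Rep_irrep_three.commutator i
  have c3 := h₃.commutator₃ i
  have c1 := h₁.commutator₁ i
  have d3 := h₃.conjTranspose_commutator i
  have e3 := h₃.irrep_mul_sub i
  have e3' := h₃.mul_irrep_sub i
  have e1 := h₁.irrep_three_mul_sub i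
  have m := h₃.mul_comm h₁ (i + 1) (i + 2)
  have d1 : (B₁ (i + 1))ᴴ * B₁ (i + 2) - (B₁ (i + 2))ᴴ * B₁ (i + 1) = 0 := by
    rw [h₁.conjTranspose_mul_eq_zero, ← conjTranspose_conjTranspose (_ * B₁ (i + 1)),
      conjTranspose_mul, conjTranspose_conjTranspose, h₁.conjTranspose_mul_eq_zero]
    simp
  have e3h := congrArg conjTranspose e3
  have e3h' := congrArg conjTranspose e3'
  have e1h := congrArg conjTranspose e1
  have mh := congrArg conjTranspose m
  simp only [conjTranspose_sub, conjTranspose_mul, conjTranspose_irrep, conjTranspose_smul,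
    conjTranspose_neg, Matrix.mul_neg, Matrix.neg_mul, star_ofNat] at e3h e3h' e1h mh
  have n0 : (Complex.normSq g₀ : ℂ) = star g₀ * g₀ := Complex.normSq_eq_conj_mul_self
  have n1 : (Complex.normSq g₁ : ℂ) = star g₁ * g₁ := Complex.normSq_eq_conj_mul_self
  simp only [complexAnsatz, blockMatrix_mul, blockMatrix_sub, blockMatrix_inj]
  simp only [Matrix.smul_mul, Matrix.mul_smul, Matrix.mul_neg, Matrix.neg_mul, Matrix.zero_mul,
    Matrix.mul_zero, smul_smul, add_zero, zero_add, smul_zero, neg_zero]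
  push_cast
  rw [n0, n1]
  simp only [star_mul', star_sub, star_ofNat, RCLike.star_def, Complex.conj_ofReal]
  set c₀ := (starRingEnd ℂ) g₀
  set c₁ := (starRingEnd ℂ) g₁
  refine ⟨⟨?_, ?_, ?_⟩, ⟨?_, ?_, ?_⟩, ?_, ?_, ?_⟩
  · linear_combination (norm := module) ((f₂ : ℂ) ^ 2) • a5 - (c₁ * g₁) • c3
  · linear_combination (norm := module) ((f₂ : ℂ) * g₁) • e3 + ((f₁ : ℂ) * g₁) • e3'
  · linear_combination (norm := module) (g₁ * g₀) • m
  · linear_combination (norm := module) -((f₂ : ℂ) * c₁) • e3h - ((f₁ : ℂ) * c₁) • e3h'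
  · linear_combination (norm := module) ((f₁ : ℂ) ^ 2) • a3 - (c₁ * g₁) • d3 - (c₀ * g₀) • c1
  · linear_combination (norm := module) ((f₁ : ℂ) * g₀) • e1
  · linear_combination (norm := module) -(c₁ * c₀) • mh
  · linear_combination (norm := module) -((f₁ : ℂ) * c₀) • e1h
  · linear_combination (norm := module) (-c₀ * g₀) • d1

theorem isSu_complexAnsatz (f₁ f₂ : ℝ) (g₀ g₁ : ℂ) (i : Fin 3) :
    IsSu (complexAnsatz B₃ B₁ f₁ f₂ g₀ g₁ i) := by
  refine ⟨?_, ?_⟩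
  · simp only [complexAnsatz, blockMatrix_conjTranspose, blockMatrix_neg, conjTranspose_smul,
      conjTranspose_neg, conjTranspose_irrep, conjTranspose_zero, conjTranspose_conjTranspose,
      smul_neg, neg_neg, RCLike.star_def, Complex.conj_ofReal, neg_zero,
      Complex.conj_conj]
  · simp [complexAnsatz, blockMatrix_trace, trace_irrep_five, trace_irrep_three]

theorem conjTranspose_rep531 (i : Fin 3) : (rep531 i)ᴴ = -rep531 i := by
  simp [rep531_eq_blockMatrix, blockMatrix_conjTranspose, blockMatrix_neg, conjTranspose_irrep]

theorem isSu_rep531 (i : Fin 3) : IsSu (rep531 i) :=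
  ⟨conjTranspose_rep531 i, by
    simp [rep531_eq_blockMatrix, blockMatrix_trace, trace_irrep_five, trace_irrep_three]⟩

theorem sum_smul_blockMatrix (c : Fin 3 → ℂ) (A₁₁ : Fin 3 → Matrix (Fin 5) (Fin 5) ℂ)
    (A₁₂ : Fin 3 → Matrix (Fin 5) (Fin 3) ℂ) (A₁₃ : Fin 3 → Matrix (Fin 5) (Fin 1) ℂ)
    (A₂₁ : Fin 3 → Matrix (Fin 3) (Fin 5) ℂ) (A₂₂ : Fin 3 → Matrix (Fin 3) (Fin 3) ℂ)
    (A₂₃ : Fin 3 → Matrix (Fin 3) (Fin 1) ℂ) (A₃₁ : Fin 3 → Matrix (Fin 1) (Fin 5) ℂ)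
    (A₃₂ : Fin 3 → Matrix (Fin 1) (Fin 3) ℂ) (A₃₃ : Fin 3 → Matrix (Fin 1) (Fin 1) ℂ) :
    ∑ k, c k • blockMatrix (A₁₁ k) (A₁₂ k) (A₁₃ k) (A₂₁ k) (A₂₂ k) (A₂₃ k) (A₃₁ k) (A₃₂ k)
      (A₃₃ k) = blockMatrix (∑ k, c k • A₁₁ k) (∑ k, c k • A₁₂ k) (∑ k, c k • A₁₃ k)
      (∑ k, c k • A₂₁ k) (∑ k, c k • A₂₂ k) (∑ k, c k • A₂₃ k) (∑ k, c k • A₃₁ k)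
      (∑ k, c k • A₃₂ k) (∑ k, c k • A₃₃ k) := by
  simp only [Fin.sum_univ_three, blockMatrix_smul, blockMatrix_add]

theorem IsEquivariantTriple.conjTranspose {m n : ℕ} {C : Fin 3 → Matrix (Fin m) (Fin n) ℂ}
    (hC : IsEquivariantTriple C) : IsEquivariantTriple fun i => (C i)ᴴ := by
  intro j k
  have h := congrArg Matrix.conjTranspose (hC j k)
  simp only [conjTranspose_sub, conjTranspose_mul, conjTranspose_irrep, conjTranspose_sum,
    conjTranspose_smul, Matrix.mul_neg, Matrix.neg_mul] at h
  have hs : ∀ i, star (leviCivita j k i) = leviCivita j k i := by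
    intro i
    unfold leviCivita
    split_ifs <;> simp
  simp only [hs] at h
  rw [← h]
  abel

theorem IsEquivariantTriple.smul {m n : ℕ} {C : Fin 3 → Matrix (Fin m) (Fin n) ℂ}
    (hC : IsEquivariantTriple C) (c : ℂ) : IsEquivariantTriple fun i => c • C i := by
  intro j k
  have h := hC j k
  simp only [Matrix.mul_smul, Matrix.smul_mul, ← smul_sub, h, Finset.smul_sum, smul_smul,
    mul_comm c]

theorem IsEquivariantTriple.neg {m n : ℕ} {C : Fin 3 → Matrix (Fin m) (Fin n) ℂ}
    (hC : IsEquivariantTriple C) : IsEquivariantTriple fun i => -C i := by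
  simpa using hC.smul (-1)

/-- The triple `T` is equivariant with respect to `V₅ ⊕ V₃ ⊕ V₁`: it is generated by `rep531`. -/
def IsEquivariant531 (T : Fin 3 → Matrix Idx531 Idx531 ℂ) : Prop :=
  ∀ i j, rep531 i * T j - T j * rep531 i = ∑ k, leviCivita i j k • T k

theorem isEquivariant531_complexAnsatz (h₃ : IsInvariantTriple 3 B₃) (h₁ : IsInvariantTriple 1 B₁)
    (f₁ f₂ : ℝ) (g₀ g₁ : ℂ) : IsEquivariant531 (complexAnsatz B₃ B₁ f₁ f₂ g₀ g₁) := by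
  intro i j
  have e5 := IsEquivariantTriple.smul (C := irrep 5) isSO3Rep_irrep_five (f₂ : ℂ) i j
  have e3 := IsEquivariantTriple.smul (C := irrep 3) isSO3Rep_irrep_three (f₁ : ℂ) i j
  have e53 := IsEquivariantTriple.smul (C := B₃) h₃.1 g₁ i j
  have e31 := IsEquivariantTriple.smul (C := B₁) h₁.1 g₀ i j
  have e35 := ((IsEquivariantTriple.conjTranspose (C := B₃) h₃.1).smul (star g₁)).neg i j
  have e13 := ((IsEquivariantTriple.conjTranspose (C := B₁) h₁.1).smul (star g₀)).neg i j
  rw [irrep_one] at e31 e13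
  simp only [complexAnsatz, sum_smul_blockMatrix, rep531_eq_blockMatrix, blockMatrix_mul,
    blockMatrix_sub, ← e5, ← e3, ← e53, ← e31, ← e35, ← e13]
  simp

/-- Schur's lemma for skew-Hermitian triples on `V₅ ⊕ V₃ ⊕ V₁`. -/
theorem exists_eq_complexAnsatz (h₃ : IsInvariantTriple 3 B₃) (h₁ : IsInvariantTriple 1 B₁)
    {T : Fin 3 → Matrix Idx531 Idx531 ℂ} (hT : ∀ i, (T i)ᴴ = -T i) (hE : IsEquivariant531 T) :
    T = complexAnsatz B₃ B₁ (Complex.I * T 2 (.inr (.inl 0)) (.inr (.inl 0))).re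
      (Complex.I / 2 * T 2 (.inl 0) (.inl 0)).re
      (T 2 (.inr (.inl 1)) (.inr (.inr 0)) / B₁ 2 1 0)
      (T 2 (.inl 1) (.inr (.inl 0)) / B₃ 2 1 0) := by
  obtain ⟨A, hA⟩ : ∃ A : Fin 3 → Matrix (Fin 5) (Fin 5) ℂ,
    ∀ i, A i = (T i).submatrix .inl .inl := ⟨_, fun _ => rfl⟩
  obtain ⟨C, hC⟩ : ∃ C : Fin 3 → Matrix (Fin 5) (Fin 3) ℂ,
    ∀ i, C i = (T i).submatrix .inl (.inr ∘ .inl) := ⟨_, fun _ => rfl⟩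
  obtain ⟨D, hD⟩ : ∃ D : Fin 3 → Matrix (Fin 5) (Fin 1) ℂ,
    ∀ i, D i = (T i).submatrix .inl (.inr ∘ .inr) := ⟨_, fun _ => rfl⟩
  obtain ⟨F, hF⟩ : ∃ F : Fin 3 → Matrix (Fin 3) (Fin 3) ℂ,
    ∀ i, F i = (T i).submatrix (.inr ∘ .inl) (.inr ∘ .inl) := ⟨_, fun _ => rfl⟩
  obtain ⟨G, hG⟩ : ∃ G : Fin 3 → Matrix (Fin 3) (Fin 1) ℂ,
    ∀ i, G i = (T i).submatrix (.inr ∘ .inl) (.inr ∘ .inr) := ⟨_, fun _ => rfl⟩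
  obtain ⟨K, hK⟩ : ∃ K : Fin 3 → Matrix (Fin 1) (Fin 1) ℂ,
    ∀ i, K i = (T i).submatrix (.inr ∘ .inr) (.inr ∘ .inr) := ⟨_, fun _ => rfl⟩
  -- The blocks below the diagonal are determined by those above it.
  have hblock : ∀ i, T i = blockMatrix (A i) (C i) (D i) (-(C i)ᴴ) (F i) (G i) (-(D i)ᴴ)
      (-(G i)ᴴ) (K i) := by
    intro i
    have h := fun a b => congrFun (congrFun (hT i) a) b
    simp only [conjTranspose_apply, Matrix.neg_apply] at h
    rw [hA, hC, hD, hF, hG, hK]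
    ext (a | a | a) (b | b | b)
    all_goals first | rfl | exact (neg_eq_iff_eq_neg.2 (h _ _)).symm
  have hE' := hE
  simp only [IsEquivariant531, rep531_eq_blockMatrix, hblock, blockMatrix_mul, blockMatrix_sub,
    sum_smul_blockMatrix, blockMatrix_inj, Matrix.zero_mul, Matrix.mul_zero, add_zero,
    zero_add] at hE'
  have eA : IsEquivariantTriple A := fun i j => (hE' i j).1.1
  have eC : IsEquivariantTriple C := fun i j => (hE' i j).1.2.1
  have eD : IsEquivariantTriple D := fun i j => by
    rw [irrep_one, Matrix.mul_zero]; exact (hE' i j).1.2.2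
  have eF : IsEquivariantTriple F := fun i j => (hE' i j).2.1.2.1
  have eG : IsEquivariantTriple G := fun i j => by
    rw [irrep_one, Matrix.mul_zero]; exact (hE' i j).2.1.2.2
  have eK : IsEquivariantTriple K := fun i j => by
    rw [irrep_one, Matrix.mul_zero, Matrix.zero_mul]; exact (hE' i j).2.2.2.2
  have hA2 := eA.eq_smul isSO3Rep_irrep_five eA.eq_smul_irrep_five
  have hF2 := eF.eq_smul isSO3Rep_irrep_three eF.eq_smul_irrep_three
  have hC2 : ∀ i, C i = (C 2 1 0 / B₃ 2 1 0) • B₃ i := by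
    refine eC.eq_smul h₃.1 ?_
    have h0 := h₃.apply_two_one_zero_ne_zero₃
    have h2 : B₃ 2 = (rootTwo * B₃ 2 1 0) • stdTriple₃ 2 :=
      IsEquivariantTriple.eq_smul_stdTriple₃ h₃.1
    generalize B₃ 2 1 0 = b at h0 h2 ⊢
    conv_lhs => rw [eC.eq_smul_stdTriple₃]
    conv_rhs => rw [h2, smul_smul]
    congr 1
    field_simp
  have hG2 : ∀ i, G i = (G 2 1 0 / B₁ 2 1 0) • B₁ i := by
    refine eG.eq_smul h₁.1 ?_
    have h0 := h₁.apply_two_one_zero_ne_zero₁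
    have h2 : B₁ 2 = (B₁ 2 1 0) • stdTriple₁ 2 :=
      IsEquivariantTriple.eq_smul_stdTriple₁ h₁.1
    generalize B₁ 2 1 0 = b at h0 h2 ⊢
    conv_lhs => rw [eG.eq_smul_stdTriple₁]
    conv_rhs => rw [h2, smul_smul]
    congr 1
    field_simp
  -- The diagonal coefficients are real because `T` is skew-Hermitian.
  have hre : ∀ a, (T 2 a a).re = 0 := by
    intro a
    have h := congrArg Complex.re (congrFun (congrFun (hT 2) a) a)
    simp only [conjTranspose_apply, Matrix.neg_apply, RCLike.star_def, Complex.conj_re,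
      Complex.neg_re] at h
    linarith
  funext i
  rw [hblock i, complexAnsatz, hA2 i, hF2 i, hC2 i, hG2 i, eD.five_one_eq_zero,
    eK.one_one_eq_zero, hA, hF, hC, hG]
  have r1 : ((Complex.I * T 2 (.inr (.inl 0)) (.inr (.inl 0))).re : ℂ) =
      Complex.I * T 2 (.inr (.inl 0)) (.inr (.inl 0)) := by
    apply Complex.ext <;> simp [hre]
  have r2 : ((Complex.I / 2 * T 2 (.inl 0) (.inl 0)).re : ℂ) =
      Complex.I / 2 * T 2 (.inl 0) (.inl 0) := by
    apply Complex.ext <;> simp [hre]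
  rw [r1, r2]
  simp

end Ansatz

/-! ### Unitary equivalence of skew-Hermitian representations -/

section Unitary

variable {n : Type*} [Fintype n] [DecidableEq n]

theorem commute_diagonal_comp {M : Matrix n n ℂ} {d : n → ℝ} (φ : ℝ → ℝ)
    (h : M * Matrix.diagonal (fun i => (d i : ℂ)) = Matrix.diagonal (fun i => (d i : ℂ)) * M) :
    M * Matrix.diagonal (fun i => ((φ (d i) : ℝ) : ℂ)) =
      Matrix.diagonal (fun i => ((φ (d i) : ℝ) : ℂ)) * M := by
  ext i j
  have hij := congrFun (congrFun h i) j
  rw [mul_diagonal, diagonal_mul] at hij ⊢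
  by_cases hd : d i = d j
  · rw [hd, mul_comm]
  · have h0 : M i j = 0 := by
      have : ((d i : ℂ) - d j) * M i j = 0 := by linear_combination -hij
      refine (mul_eq_zero.1 this).resolve_left (sub_ne_zero.2 ?_)
      exact_mod_cast hd
    rw [h0, zero_mul, mul_zero]

open scoped ComplexOrder in
/-- Skew-Hermitian triples that are isomorphic are unitarily equivalent: the unitary part of the
polar decomposition of an intertwiner is again an intertwiner. -/
theorem RepIso.exists_unitary {Y Z : Fin 3 → Matrix n n ℂ} (h : RepIso Y Z)
    (hY : ∀ i, (Y i)ᴴ = -Y i) (hZ : ∀ i, (Z i)ᴴ = -Z i) :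
    ∃ U : Matrix n n ℂ, Uᴴ * U = 1 ∧ U * Uᴴ = 1 ∧ ∀ i, U * Y i = Z i * U := by
  obtain ⟨e, he⟩ := h
  set P : Matrix n n ℂ := LinearMap.toMatrix' e.toLinearMap with hP
  have hPv : ∀ v, P *ᵥ v = e v := fun v => LinearMap.toMatrix'_mulVec _ _
  have hPY : ∀ i, P * Y i = Z i * P := fun i => by
    refine Matrix.ext_of_mulVec_single fun j => ?_
    rw [← mulVec_mulVec, ← mulVec_mulVec, hPv, hPv, he]
  have hPinj : Function.Injective P.mulVec := fun v w hvw => e.injective (by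
    rw [← hPv, ← hPv]; exact hvw)
  have hpos : (Pᴴ * P).PosDef := PosDef.conjTranspose_mul_self P hPinj
  have hH := hpos.isHermitian
  have hcomm : ∀ i, Pᴴ * P * Y i = Y i * (Pᴴ * P) := fun i => by
    have h1 := congrArg conjTranspose (hPY i)
    rw [conjTranspose_mul, conjTranspose_mul, hY, hZ, Matrix.neg_mul, Matrix.mul_neg,
      neg_inj] at h1
    rw [Matrix.mul_assoc, hPY, ← Matrix.mul_assoc, ← h1, Matrix.mul_assoc]
  -- Diagonalize `P* P = V D V*` and put `S = V D^{-1/2} V*`.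
  set V : Matrix n n ℂ := (hH.eigenvectorUnitary : Matrix n n ℂ) with hV
  have hVV : Vᴴ * V = 1 := (mem_unitaryGroup_iff'.1 hH.eigenvectorUnitary.2)
  have hVV' : V * Vᴴ = 1 := (mem_unitaryGroup_iff.1 hH.eigenvectorUnitary.2)
  set d := hH.eigenvalues with hd
  have hdpos : ∀ i, 0 < d i := hpos.eigenvalues_pos
  have hspec : Pᴴ * P = V * Matrix.diagonal (fun i => (d i : ℂ)) * Vᴴ := by
    have := hH.spectral_theorem
    exact this
  set E : Matrix n n ℂ := Matrix.diagonal (fun i => (((Real.sqrt (d i))⁻¹ : ℝ) : ℂ)) with hE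
  have hEE : Eᴴ = E := by
    rw [hE, diagonal_conjTranspose]
    congr 1
    ext i
    simp
  have hEDE : E * Matrix.diagonal (fun i => (d i : ℂ)) * E = 1 := by
    rw [hE, diagonal_mul_diagonal, diagonal_mul_diagonal, ← Matrix.diagonal_one]
    congr 1
    ext i
    rw [← Complex.ofReal_mul, ← Complex.ofReal_mul]
    have h0 := Real.sqrt_pos.2 (hdpos i)
    have h1 := Real.mul_self_sqrt (hdpos i).le
    rw [← Complex.ofReal_one]
    congr 1
    field_simp
    nlinarith
  have hYV : ∀ i, Vᴴ * Y i * V * E = E * (Vᴴ * Y i * V) := fun i => by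
    refine commute_diagonal_comp (fun x => (Real.sqrt x)⁻¹) ?_
    have h1 := hcomm i
    rw [hspec] at h1
    have h2 := congrArg (fun M => Vᴴ * M * V) h1
    simp only [Matrix.mul_assoc, hVV, Matrix.mul_one] at h2
    simp only [← Matrix.mul_assoc, hVV, Matrix.one_mul] at h2
    simp only [Matrix.mul_assoc] at h2 ⊢
    exact h2.symm
  have hU : (P * (V * E * Vᴴ))ᴴ * (P * (V * E * Vᴴ)) = 1 := by
    calc (P * (V * E * Vᴴ))ᴴ * (P * (V * E * Vᴴ))
        = V * E * (Vᴴ * (Pᴴ * P) * V) * E * Vᴴ := by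
          simp only [conjTranspose_mul, conjTranspose_conjTranspose, hEE, Matrix.mul_assoc]
      _ = V * (E * Matrix.diagonal (fun i => (d i : ℂ)) * E) * Vᴴ := by
          rw [hspec]
          simp only [← Matrix.mul_assoc]
          simp only [Matrix.mul_assoc _ Vᴴ V, hVV, Matrix.mul_one]
      _ = 1 := by rw [hEDE, Matrix.mul_one, hVV']
  refine ⟨P * (V * E * Vᴴ), hU, mul_eq_one_comm.1 hU, fun i => ?_⟩
  have h3 : V * E * Vᴴ * Y i = Y i * (V * E * Vᴴ) := by
    have h4 := congrArg (fun M => V * M * Vᴴ) (hYV i)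
    simp only [Matrix.mul_assoc, hVV', Matrix.mul_one] at h4
    simp only [← Matrix.mul_assoc, hVV', Matrix.one_mul] at h4
    simp only [Matrix.mul_assoc] at h4 ⊢
    exact h4.symm
  rw [Matrix.mul_assoc, h3, ← Matrix.mul_assoc, hPY, Matrix.mul_assoc]

/-- A unitary matrix becomes special after multiplication by a scalar of modulus one. -/
theorem exists_smul_mem_specialUnitaryGroup [Nonempty n] {U : Matrix n n ℂ} (hU : Uᴴ * U = 1) :
    ∃ c : ℂ, star c * c = 1 ∧ c • U ∈ specialUnitaryGroup n ℂ := by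
  have hdet : ‖U.det‖ = 1 := by
    have h := congrArg Matrix.det hU
    rw [det_mul, det_conjTranspose, det_one, RCLike.star_def, Complex.conj_mul'] at h
    have h' : ‖U.det‖ ^ 2 = 1 := by exact_mod_cast h
    nlinarith [norm_nonneg U.det]
  have hcard : Fintype.card n ≠ 0 := Fintype.card_ne_zero
  obtain ⟨c, hc⟩ := IsAlgClosed.exists_pow_nat_eq (U.det)⁻¹ (Nat.pos_of_ne_zero hcard)
  have hcn : ‖c‖ = 1 := by
    have h := congrArg norm hc
    rw [norm_pow, norm_inv, hdet, inv_one] at h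
    exact (pow_eq_one_iff_of_nonneg (norm_nonneg _) hcard).1 h
  have hcc : star c * c = 1 := by
    rw [RCLike.star_def, Complex.conj_mul', hcn]; simp
  have hd0 : U.det ≠ 0 := by
    intro h0
    rw [h0, norm_zero] at hdet
    exact zero_ne_one hdet
  refine ⟨c, hcc, mem_specialUnitaryGroup_iff.2 ⟨mem_unitaryGroup_iff'.2 ?_, ?_⟩⟩
  · rw [star_eq_conjTranspose, conjTranspose_smul, Matrix.smul_mul, Matrix.mul_smul, smul_smul,
      hcc, one_smul, hU]
  · rw [det_smul, hc, inv_mul_cancel₀ hd0]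

end Unitary

/-! ### Linear and quadratic differential equations -/

/-- A solution of the linear equation `g' = φ g` with `φ` real has constant phase. -/
theorem exists_eq_phase_mul_of_hasDerivAt {I : Set ℝ} (hI : IsOpen I) (hI' : IsConnected I)
    {φ : ℝ → ℝ} (hφ : ContinuousOn φ I) {g : ℝ → ℂ}
    (hg : ∀ t ∈ I, HasDerivAt g ((φ t : ℂ) * g t) t) :
    ∃ u : ℂ, star u * u = 1 ∧ ∃ r : ℝ → ℝ, (∀ t ∈ I, g t = u * r t) ∧
      ∀ t ∈ I, HasDerivAt r (φ t * r t) t := by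
  obtain ⟨t₀, ht₀⟩ := hI'.nonempty
  have hord : I.OrdConnected := hI'.isPreconnected.ordConnected
  have hint : ∀ t ∈ I, IntervalIntegrable φ MeasureTheory.volume t₀ t := fun t ht =>
    (hφ.mono (hord.uIcc_subset ht₀ ht)).intervalIntegrable
  have hΦ : ∀ t ∈ I, HasDerivAt (fun s => ∫ x in t₀..s, φ x) (φ t) t := fun t ht =>
    intervalIntegral.integral_hasDerivAt_right (hint t ht)
      (hφ.stronglyMeasurableAtFilter hI t ht) (hφ.continuousAt (hI.mem_nhds ht))
  set Φ : ℝ → ℝ := fun s => ∫ x in t₀..s, φ x with hΦdef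
  -- The integrating factor `exp (-Φ)` makes `g` constant.
  have hk : ∀ t ∈ I, HasDerivAt (fun s => ((Real.exp (-Φ s) : ℝ) : ℂ) * g s) 0 t := by
    intro t ht
    have h1 := (((hΦ t ht).neg).exp).ofReal_comp.mul (hg t ht)
    refine h1.congr_deriv ?_
    push_cast
    ring
  have hconst : ∀ t ∈ I, ((Real.exp (-Φ t) : ℝ) : ℂ) * g t = g t₀ := by
    intro t ht
    have h0 : ((Real.exp (-Φ t₀) : ℝ) : ℂ) * g t₀ = g t₀ := by simp [hΦdef]
    rw [← h0]
    exact hI.is_const_of_deriv_eq_zero hI'.isPreconnected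
      (fun s hs => (hk s hs).differentiableAt.differentiableWithinAt)
      (fun s hs => (hk s hs).deriv) ht ht₀
  obtain ⟨u, hu, hu'⟩ : ∃ u : ℂ, star u * u = 1 ∧ g t₀ = u * (‖g t₀‖ : ℝ) := by
    by_cases h : g t₀ = 0
    · exact ⟨1, by simp, by simp [h]⟩
    · have hn : ((‖g t₀‖ : ℝ) : ℂ) ≠ 0 := by simpa using h
      refine ⟨g t₀ / (‖g t₀‖ : ℝ), ?_, by field_simp⟩
      have := Complex.conj_mul' (g t₀)
      rw [RCLike.star_def, map_div₀, Complex.conj_ofReal, div_mul_div_comm, this, sq,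
        div_self (mul_ne_zero hn hn)]
  refine ⟨u, hu, fun t => ‖g t₀‖ * Real.exp (Φ t), ?_, ?_⟩
  · intro t ht
    have h := hconst t ht
    rw [hu'] at h
    have he : ((Real.exp (Φ t) : ℝ) : ℂ) * ((Real.exp (-Φ t) : ℝ) : ℂ) = 1 := by
      rw [← Complex.ofReal_mul, ← Real.exp_add]; simp
    push_cast
    push_cast at h he
    linear_combination (-g t) * he + Complex.exp (Φ t) * h
  · intro t ht
    refine ((hΦ t ht).exp.const_mul ‖g t₀‖).congr_deriv ?_
    ring

/-- The Taylor coefficients of the solution of the quadratic system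
`xᵢ' = ∑ⱼₖ qᵢⱼₖ xⱼ xₖ` with initial value `x₀`. -/
noncomputable def quadraticCoeff {ι : Type*} [Fintype ι] (q : ι → ι → ι → ℝ) (x₀ : ι → ℝ) :
    ℕ → ι → ℝ
  | 0 => x₀
  | n + 1 => fun i => ((n : ℝ) + 1)⁻¹ * ∑ j, ∑ k, q i j k *
      ∑ l : Fin (n + 1), quadraticCoeff q x₀ l j * quadraticCoeff q x₀ (n - l) k
  decreasing_by all_goals omega

section Quadratic

variable {ι : Type*} [Fintype ι] (q : ι → ι → ι → ℝ) (x₀ : ι → ℝ)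

theorem quadraticCoeff_zero : quadraticCoeff q x₀ 0 = x₀ := by
  rw [quadraticCoeff]

theorem quadraticCoeff_succ (n : ℕ) (i : ι) : ((n : ℝ) + 1) * quadraticCoeff q x₀ (n + 1) i =
    ∑ j, ∑ k, q i j k * ∑ p ∈ Finset.HasAntidiagonal.antidiagonal n,
      quadraticCoeff q x₀ p.1 j * quadraticCoeff q x₀ p.2 k := by
  rw [quadraticCoeff, mul_inv_cancel_left₀ (by positivity)]
  refine Finset.sum_congr rfl fun j _ => Finset.sum_congr rfl fun k _ => ?_
  rw [Finset.Nat.sum_antidiagonal_eq_sum_range_succ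
    (fun a b => quadraticCoeff q x₀ a j * quadraticCoeff q x₀ b k), Finset.sum_range]

theorem exists_quadraticCoeff_bound : ∃ M > 0, ∃ K > 0, ∀ n i,
    |quadraticCoeff q x₀ n i| ≤ M * K ^ n := by
  refine ⟨1 + ∑ i, |x₀ i|, by positivity, 
    1 + (1 + ∑ i, |x₀ i|) * ∑ i, ∑ j, ∑ k, |q i j k|, by positivity, fun n => ?_⟩
  set M := 1 + ∑ i, |x₀ i| with hM
  set Q := ∑ i, ∑ j, ∑ k, |q i j k| with hQ
  have hM0 : 0 < M := by positivity
  have hQ0 : 0 ≤ Q := by positivity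
  set K := 1 + M * Q with hK
  have hK0 : 0 < K := by positivity
  induction n using Nat.strong_induction_on with
  | _ n ih =>
    intro i
    cases n with
    | zero =>
      rw [quadraticCoeff_zero, pow_zero, mul_one, hM]
      have := Finset.single_le_sum (f := fun i => |x₀ i|) (fun i _ => abs_nonneg _)
        (Finset.mem_univ i)
      linarith
    | succ n =>
      have hs : ∀ j k, |∑ p ∈ Finset.HasAntidiagonal.antidiagonal n,
          quadraticCoeff q x₀ p.1 j * quadraticCoeff q x₀ p.2 k| ≤
          ((n : ℝ) + 1) * (M ^ 2 * K ^ n) := by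
        intro j k
        refine (Finset.abs_sum_le_sum_abs _ _).trans ?_
        have : ∀ p ∈ Finset.HasAntidiagonal.antidiagonal n,
            |quadraticCoeff q x₀ p.1 j * quadraticCoeff q x₀ p.2 k| ≤ M ^ 2 * K ^ n := by
          intro p hp
          have hp' := Finset.HasAntidiagonal.mem_antidiagonal.1 hp
          rw [abs_mul, ← hp', pow_add]
          refine (mul_le_mul (ih p.1 (by omega) j) (ih p.2 (by omega) k) (abs_nonneg _)
            (by positivity)).trans_eq ?_
          ring
        refine (Finset.sum_le_card_nsmul _ _ _ this).trans_eq ?_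
        simp [Finset.Nat.card_antidiagonal]
      have hsum : |((n : ℝ) + 1) * quadraticCoeff q x₀ (n + 1) i| ≤
          Q * (((n : ℝ) + 1) * (M ^ 2 * K ^ n)) := by
        rw [quadraticCoeff_succ]
        refine (Finset.abs_sum_le_sum_abs _ _).trans ?_
        have h1 : ∑ j, |∑ k, q i j k * ∑ p ∈ Finset.HasAntidiagonal.antidiagonal n,
            quadraticCoeff q x₀ p.1 j * quadraticCoeff q x₀ p.2 k| ≤
            ∑ j, ∑ k, |q i j k| * (((n : ℝ) + 1) * (M ^ 2 * K ^ n)) := by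
          refine Finset.sum_le_sum fun j _ => (Finset.abs_sum_le_sum_abs _ _).trans ?_
          refine Finset.sum_le_sum fun k _ => ?_
          rw [abs_mul]
          exact mul_le_mul_of_nonneg_left (hs j k) (abs_nonneg _)
        refine h1.trans ?_
        simp only [← Finset.sum_mul]
        refine mul_le_mul_of_nonneg_right ?_ (by positivity)
        exact Finset.single_le_sum (f := fun i => ∑ j, ∑ k, |q i j k|)
          (fun i _ => by positivity) (Finset.mem_univ i)
      rw [abs_mul, abs_of_pos (by positivity : (0 : ℝ) < (n : ℝ) + 1)] at hsum
      have hn : (0 : ℝ) < (n : ℝ) + 1 := by positivity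
      have h2 : |quadraticCoeff q x₀ (n + 1) i| ≤ Q * (M ^ 2 * K ^ n) := by
        refine le_of_mul_le_mul_left ?_ hn
        linarith
      refine h2.trans ?_
      have h3 : 0 ≤ M * K ^ n := by positivity
      calc Q * (M ^ 2 * K ^ n) = M * Q * (M * K ^ n) := by ring
        _ ≤ K * (M * K ^ n) := by gcongr; linarith
        _ = M * K ^ (n + 1) := by ring

/-- The power series solution of a quadratic system. -/
theorem exists_analytic_quadratic_solution (t₀ : ℝ) : ∃ y : ι → ℝ → ℝ,
    (∀ i, AnalyticAt ℝ (y i) t₀) ∧ (∀ i, y i t₀ = x₀ i) ∧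
    ∀ᶠ t in 𝓝 t₀, ∀ i, HasDerivAt (y i) (∑ j, ∑ k, q i j k * (y j t * y k t)) t := by
  obtain ⟨M, hM, K, hK, hbound⟩ := exists_quadraticCoeff_bound q x₀
  set a := quadraticCoeff q x₀ with ha
  let p : ι → FormalMultilinearSeries ℝ ℝ ℝ := fun i =>
    FormalMultilinearSeries.ofScalars ℝ (fun n => a n i)
  have hcoeff : ∀ i n, (p i).coeff n = a n i := fun i n =>
    FormalMultilinearSeries.coeff_ofScalars
  have hKpos : 0 < K⁻¹ := inv_pos.2 hK
  have hr : ∀ i, (K⁻¹.toNNReal : ENNReal) ≤ (p i).radius := by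
    intro i
    refine (p i).le_radius_of_bound M fun n => ?_
    rw [FormalMultilinearSeries.norm_apply_eq_norm_coef, hcoeff, Real.coe_toNNReal _ hKpos.le,
      Real.norm_eq_abs]
    calc |a n i| * K⁻¹ ^ n ≤ M * K ^ n * K⁻¹ ^ n := by gcongr; exact hbound n i
      _ = M := by rw [mul_assoc, ← mul_pow, mul_inv_cancel₀ hK.ne', one_pow, mul_one]
  have hr0 : (0 : ENNReal) < (K⁻¹.toNNReal : ENNReal) := by simpa using hK
  have hball : ∀ i, HasFPowerSeriesOnBall (fun t => (p i).sum (t - t₀)) (p i) t₀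
      (K⁻¹.toNNReal : ENNReal) := by
    intro i
    have := (((p i).hasFPowerSeriesOnBall (hr0.trans_le (hr i))).mono hr0 (hr i)).comp_sub t₀
    rwa [zero_add] at this
  refine ⟨fun i t => (p i).sum (t - t₀), fun i => (hball i).analyticAt, fun i => ?_, ?_⟩
  · have h := (hball i).coeff_zero ![]
    refine h.symm.trans ?_
    rw [FormalMultilinearSeries.apply_eq_prod_smul_coeff, hcoeff, ha, quadraticCoeff_zero]
    simp
  · have hnhds : Metric.ball t₀ K⁻¹ ∈ 𝓝 t₀ := Metric.ball_mem_nhds _ hKpos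
    filter_upwards [hnhds] with t ht i
    have ht' : t ∈ Metric.eball t₀ (K⁻¹.toNNReal : ENNReal) := by
      rw [← ENNReal.ofReal, Metric.eball_ofReal]; exact ht
    set z := t - t₀ with hz
    have hzK : |z| * K < 1 := by
      rw [Metric.mem_ball, Real.dist_eq] at ht
      calc |z| * K < K⁻¹ * K := by gcongr
        _ = 1 := inv_mul_cancel₀ hK.ne'
    have hsummable : ∀ j, Summable fun n => ‖a n j * z ^ n‖ := by
      intro j
      refine Summable.of_nonneg_of_le (fun _ => norm_nonneg _) (fun n => ?_)
        ((summable_geometric_of_lt_one (by positivity) hzK).mul_left M)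
      rw [norm_mul, norm_pow, Real.norm_eq_abs, Real.norm_eq_abs, mul_pow]
      calc |a n j| * |z| ^ n ≤ M * K ^ n * |z| ^ n := by gcongr; exact hbound n j
        _ = M * (|z| ^ n * K ^ n) := by ring
    have hval : ∀ j, (p j).sum z = ∑' n, a n j * z ^ n := by
      intro j
      have h := (hball j).hasSum_sub ht'
      refine h.tsum_eq.symm.trans (tsum_congr fun n => ?_)
      rw [FormalMultilinearSeries.apply_eq_pow_smul_coeff, hcoeff, smul_eq_mul, mul_comm]
    have hprod : ∀ j k, HasSum (fun n => (∑ l ∈ Finset.HasAntidiagonal.antidiagonal n,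
        a l.1 j * a l.2 k) * z ^ n) ((p j).sum z * (p k).sum z) := by
      intro j k
      rw [hval, hval, tsum_mul_tsum_eq_tsum_sum_antidiagonal_of_summable_norm (hsummable j)
        (hsummable k)]
      have hs := (summable_norm_sum_mul_antidiagonal_of_summable_norm (hsummable j)
        (hsummable k)).of_norm.hasSum
      refine HasSum.congr_fun hs fun n => ?_
      rw [Finset.sum_mul]
      refine Finset.sum_congr rfl fun l hl => ?_
      rw [← Finset.HasAntidiagonal.mem_antidiagonal.1 hl, pow_add]
      ring
    have hdiff : DifferentiableAt ℝ (fun t => (p i).sum (t - t₀)) t := by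
      refine ((hball i).differentiableOn.differentiableAt ?_)
      exact Metric.isOpen_eball.mem_nhds ht'
    have hderiv : HasSum (fun n : ℕ => z ^ n * (((n : ℝ) + 1) * a (n + 1) i))
        (deriv (fun t => (p i).sum (t - t₀)) t) := by
      have h := (ContinuousLinearMap.apply ℝ ℝ (1 : ℝ)).hasSum ((hball i).fderiv.hasSum_sub ht')
      refine HasSum.congr_fun h fun n => ?_
      change _ = ((p i).derivSeries n fun _ => t - t₀) 1
      rw [FormalMultilinearSeries.apply_eq_pow_smul_coeff, _root_.smul_apply,
        FormalMultilinearSeries.derivSeries_coeff_one, hcoeff]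
      simp [hz]
    have hrhs : HasSum (fun n : ℕ => z ^ n * (((n : ℝ) + 1) * a (n + 1) i))
        (∑ j, ∑ k, q i j k * ((p j).sum z * (p k).sum z)) := by
      have h := hasSum_sum (s := Finset.univ) fun j _ => hasSum_sum (s := Finset.univ)
        fun k _ => (hprod j k).mul_left (q i j k)
      refine HasSum.congr_fun h fun n => ?_
      rw [ha, quadraticCoeff_succ, Finset.mul_sum]
      refine Finset.sum_congr rfl fun j _ => ?_
      rw [Finset.mul_sum]
      refine Finset.sum_congr rfl fun k _ => ?_
      ring
    rw [← hderiv.unique hrhs]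
    exact hdiff.hasDerivAt

/-- Solutions of a system of quadratic differential equations are real analytic. -/
theorem analyticOnNhd_of_quadratic {q : ι → ι → ι → ℝ} {x : ι → ℝ → ℝ} {I : Set ℝ}
    (hI : IsOpen I)
    (hx : ∀ t ∈ I, ∀ i, HasDerivAt (x i) (∑ j, ∑ k, q i j k * (x j t * x k t)) t) (i : ι) :
    AnalyticOnNhd ℝ (x i) I := by
  intro t₀ ht₀
  obtain ⟨y, hya, hy0, hy⟩ := exists_analytic_quadratic_solution q (fun i => x i t₀) t₀
  let v : (ι → ℝ) → (ι → ℝ) := fun w i => ∑ j, ∑ k, q i j k * (w j * w k)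
  have hv : ContDiff ℝ 1 v := by
    refine contDiff_pi.2 fun i => ContDiff.sum fun j _ => ContDiff.sum fun k _ => ?_
    exact contDiff_const.mul ((contDiff_apply ℝ ℝ j).mul (contDiff_apply ℝ ℝ k))
  obtain ⟨K, s, hs, hK⟩ := (hv.contDiffAt (x := fun i => x i t₀)).exists_lipschitzOnWith
  have hxd : ∀ t ∈ I, HasDerivAt (fun t i => x i t) (v fun i => x i t) t := fun t ht =>
    hasDerivAt_pi.2 (hx t ht)
  have hyd : ∀ᶠ t in 𝓝 t₀, HasDerivAt (fun t i => y i t) (v fun i => y i t) t := by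
    filter_upwards [hy] with t ht
    exact hasDerivAt_pi.2 ht
  have heq : (fun t i => x i t) =ᶠ[𝓝 t₀] fun t i => y i t := by
    refine ODE_solution_unique_of_eventually (v := fun _ => v) (K := K) (s := fun _ => s)
      (.of_forall fun _ => hK) ?_ ?_ ?_
    · filter_upwards [hI.mem_nhds ht₀,
        (hxd t₀ ht₀).continuousAt.preimage_mem_nhds hs] with t ht hts
      exact ⟨hxd t ht, hts⟩
    · have hc := hyd.self_of_nhds.continuousAt
      have hs' : s ∈ 𝓝 (fun i => y i t₀) := by
        rwa [show (fun i => y i t₀) = fun i => x i t₀ from funext hy0]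
      filter_upwards [hyd, hc.preimage_mem_nhds hs'] with t ht hts
      exact ⟨ht, hts⟩
    · exact funext fun i => (hy0 i).symm
  refine (hya i).congr ?_
  filter_upwards [heq] with t ht
  exact (congrFun ht i).symm

end Quadratic

/-! ### Rotations are implemented by exponentials of the generators -/

section Rotations

section Exponential

variable {𝔸 : Type*} [NormedRing 𝔸] [NormedAlgebra ℝ 𝔸] [CompleteSpace 𝔸]

/-- The linear equation `A' = [Y, A]` is solved by conjugation with `exp (θ Y)`. -/
theorem eq_exp_mul_mul_exp_of_hasDerivAt {Y : 𝔸} {A : ℝ → 𝔸}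
    (hA : ∀ θ, HasDerivAt A (Y * A θ - A θ * Y) θ) (θ : ℝ) :
    A θ = NormedSpace.exp (θ • Y) * A 0 * NormedSpace.exp (θ • -Y) := by
  have hinv : ∀ θ : ℝ, NormedSpace.exp (θ • Y) * NormedSpace.exp (θ • -Y) = 1 := by
    intro θ
    let _ : NormedAlgebra ℚ 𝔸 := NormedAlgebra.restrictScalars ℚ ℝ 𝔸
    rw [← NormedSpace.exp_add_of_commute, smul_neg, add_neg_cancel, NormedSpace.exp_zero]
    rw [smul_neg]
    exact (Commute.refl _).neg_right
  have hconst : ∀ θ, HasDerivAt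
      (fun θ : ℝ => NormedSpace.exp (θ • -Y) * A θ * NormedSpace.exp (θ • Y)) 0 θ := by
    intro θ
    have h := ((hasDerivAt_exp_smul_const (𝕂 := ℝ) (-Y) θ).mul (hA θ)).mul
      (hasDerivAt_exp_smul_const' (𝕂 := ℝ) Y θ)
    refine h.congr_deriv ?_
    simp only [Pi.mul_apply]
    noncomm_ring
  have h := is_const_of_deriv_eq_zero (fun θ => (hconst θ).differentiableAt)
    (fun θ => (hconst θ).deriv) θ 0
  simp only [zero_smul, NormedSpace.exp_zero, one_mul, mul_one] at h
  have hinv' : NormedSpace.exp (θ • -Y) * NormedSpace.exp (θ • Y) = 1 := by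
    have := hinv (-θ)
    rwa [neg_smul_neg, neg_smul, ← smul_neg] at this
  rw [← h]
  calc A θ = (NormedSpace.exp (θ • Y) * NormedSpace.exp (θ • -Y)) * A θ *
        (NormedSpace.exp (θ • Y) * NormedSpace.exp (θ • -Y)) := by rw [hinv, one_mul, mul_one]
    _ = _ := by simp only [mul_assoc]

theorem exp_mul_mul_exp_eq_self {Y T : 𝔸} (h : Y * T - T * Y = 0) (θ : ℝ) :
    T = NormedSpace.exp (θ • Y) * T * NormedSpace.exp (θ • -Y) := by
  refine eq_exp_mul_mul_exp_of_hasDerivAt (A := fun _ => T) (fun θ => ?_) θ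
  rw [h]
  exact hasDerivAt_const _ _

theorem cos_smul_add_sin_smul_eq {Y T S : 𝔸} (h : Y * T - T * Y = S) (h' : Y * S - S * Y = -T)
    (θ : ℝ) : Real.cos θ • T + Real.sin θ • S =
      NormedSpace.exp (θ • Y) * T * NormedSpace.exp (θ • -Y) := by
  have := eq_exp_mul_mul_exp_of_hasDerivAt
    (A := fun θ => Real.cos θ • T + Real.sin θ • S) (Y := Y) (fun θ => ?_) θ
  · simpa using this
  · refine (((Real.hasDerivAt_cos θ).smul_const T).add
      ((Real.hasDerivAt_sin θ).smul_const S)).congr_deriv ?_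
    simp only [mul_add, add_mul, mul_smul_comm, smul_mul_assoc]
    rw [← sub_eq_zero] at h h'
    have e : (Real.cos θ • (Y * T) + Real.sin θ • (Y * S) -
        (Real.cos θ • (T * Y) + Real.sin θ • (S * Y))) =
        Real.cos θ • (Y * T - T * Y - S) + Real.sin θ • (Y * S - S * Y - -T) +
          (Real.cos θ • S - Real.sin θ • T) := by module
    rw [e, h, h']
    module

end Exponential

/-- Rotation about the third axis. -/
noncomputable def rotationZ (θ : ℝ) : Matrix (Fin 3) (Fin 3) ℝ :=
  !![Real.cos θ, Real.sin θ, 0; -Real.sin θ, Real.cos θ, 0; 0, 0, 1]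

/-- Rotation about the first axis. -/
noncomputable def rotationX (θ : ℝ) : Matrix (Fin 3) (Fin 3) ℝ :=
  !![1, 0, 0; 0, Real.cos θ, Real.sin θ; 0, -Real.sin θ, Real.cos θ]

theorem rotationZ_neg_mul (θ : ℝ) : rotationZ (-θ) * rotationZ θ = 1 := by
  have h := Real.sin_sq_add_cos_sq θ
  ext i j
  fin_cases i <;> fin_cases j <;> simp [rotationZ] <;> nlinarith

theorem rotationX_neg_mul (θ : ℝ) : rotationX (-θ) * rotationX θ = 1 := by
  have h := Real.sin_sq_add_cos_sq θ
  ext i j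
  fin_cases i <;> fin_cases j <;> simp [rotationX] <;> nlinarith

theorem exists_cos_sin_eq {x y : ℝ} (h : x ^ 2 + y ^ 2 = 1) :
    ∃ θ, Real.cos θ = x ∧ Real.sin θ = y := by
  have hn : ‖(⟨x, y⟩ : ℂ)‖ = 1 := by
    have := Complex.normSq_eq_norm_sq (⟨x, y⟩ : ℂ)
    rw [Complex.normSq_mk] at this
    nlinarith [norm_nonneg (⟨x, y⟩ : ℂ)]
  have h0 : (⟨x, y⟩ : ℂ) ≠ 0 := by
    intro h0
    rw [h0, norm_zero] at hn
    exact zero_ne_one hn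
  exact ⟨Complex.arg ⟨x, y⟩, by rw [Complex.cos_arg h0, hn, div_one],
    by rw [Complex.sin_arg, hn, div_one]⟩

/-- An angle that rotates `(a, b)` into the second axis. -/
theorem exists_cos_mul_add_sin_mul_eq_zero (a b : ℝ) :
    ∃ θ, Real.cos θ * a + Real.sin θ * b = 0 := by
  by_cases h : a ^ 2 + b ^ 2 = 0
  · have ha : a = 0 := by nlinarith [sq_nonneg a, sq_nonneg b]
    have hb : b = 0 := by nlinarith [sq_nonneg a, sq_nonneg b]
    exact ⟨0, by simp [ha, hb]⟩
  · have hpos : 0 < a ^ 2 + b ^ 2 := lt_of_le_of_ne (by positivity) (Ne.symm h)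
    have hr := Real.sqrt_pos.2 hpos
    have hsq := Real.sq_sqrt hpos.le
    obtain ⟨θ, hc, hs⟩ := exists_cos_sin_eq (x := b / √(a ^ 2 + b ^ 2))
      (y := -a / √(a ^ 2 + b ^ 2)) (by
        rw [div_pow, div_pow, hsq]
        field_simp
        ring)
    refine ⟨θ, ?_⟩
    rw [hc, hs]
    ring

theorem exists_eq_rotationZ {A : Matrix (Fin 3) (Fin 3) ℝ}
    (hA : A ∈ specialOrthogonalGroup (Fin 3) ℝ) (h02 : A 0 2 = 0) (h12 : A 1 2 = 0)
    (h22 : A 2 2 = 1) : ∃ θ, A = rotationZ θ := by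
  obtain ⟨ho, hd⟩ := mem_specialOrthogonalGroup_iff.1 hA
  have ho' : A * Aᵀ = 1 := (mem_orthogonalGroup_iff _ _).1 ho
  have e := fun i j => congrFun (congrFun ho' i) j
  simp only [mul_apply, transpose_apply, Fin.sum_univ_three] at e
  have e22 := e 2 2
  have e00 := e 0 0
  have e02 := e 0 2
  have e12 := e 1 2
  have e01 := e 0 1
  have e11 := e 1 1
  simp [h02, h12, h22] at e22 e00 e01 e11
  have h20 : A 2 0 = 0 := by nlinarith [sq_nonneg (A 2 0), sq_nonneg (A 2 1)]
  have h21 : A 2 1 = 0 := by nlinarith [sq_nonneg (A 2 0), sq_nonneg (A 2 1)]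
  rw [det_fin_three, h02, h12, h22, h20, h21] at hd
  obtain ⟨θ, hc, hs⟩ := exists_cos_sin_eq (x := A 0 0) (y := A 0 1) (by linarith)
  refine ⟨θ, ?_⟩
  -- The lower row of the upper left block is the upper one turned by a right angle.
  have h11 : A 1 1 = A 0 0 := by
    linear_combination A 0 0 * hd - A 1 1 * e00 + A 0 1 * e01
  have h10 : A 1 0 = -A 0 1 := by
    linear_combination -(A 0 1) * hd - A 1 0 * e00 + A 0 0 * e01
  ext i j
  fin_cases i <;> fin_cases j <;> simp [rotationZ, hc, hs, h02, h12, h22, h20, h21, h11, h10]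

theorem rotationZ_mem (θ : ℝ) : rotationZ θ ∈ specialOrthogonalGroup (Fin 3) ℝ := by
  refine mem_specialOrthogonalGroup_iff.2 ⟨(mem_orthogonalGroup_iff' _ _).2 ?_, ?_⟩
  · have ht : (rotationZ θ)ᵀ = rotationZ (-θ) := by
      ext i j
      fin_cases i <;> fin_cases j <;> simp [rotationZ]
    rw [ht, rotationZ_neg_mul]
  · rw [det_fin_three]
    have h := Real.sin_sq_add_cos_sq θ
    simp [rotationZ]
    nlinarith

theorem rotationX_mem (θ : ℝ) : rotationX θ ∈ specialOrthogonalGroup (Fin 3) ℝ := by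
  refine mem_specialOrthogonalGroup_iff.2 ⟨(mem_orthogonalGroup_iff' _ _).2 ?_, ?_⟩
  · have ht : (rotationX θ)ᵀ = rotationX (-θ) := by
      ext i j
      fin_cases i <;> fin_cases j <;> simp [rotationX]
    rw [ht, rotationX_neg_mul]
  · rw [det_fin_three]
    have h := Real.sin_sq_add_cos_sq θ
    simp [rotationX]
    nlinarith

/-- Euler angles. -/
theorem exists_eq_rotationZ_mul_rotationX_mul_rotationZ {A : Matrix (Fin 3) (Fin 3) ℝ}
    (hA : A ∈ specialOrthogonalGroup (Fin 3) ℝ) :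
    ∃ α β γ, A = rotationZ α * (rotationX β * rotationZ γ) := by
  obtain ⟨α, hα⟩ := exists_cos_mul_add_sin_mul_eq_zero (A 0 2) (A 1 2)
  have hA' := mul_mem (rotationZ_mem α) hA
  set A' := rotationZ α * A with hA'def
  have h02 : A' 0 2 = 0 := by
    rw [hA'def, mul_apply]
    simp [Fin.sum_univ_three, rotationZ, hα]
  have hcol : A' 1 2 ^ 2 + A' 2 2 ^ 2 = 1 := by
    have ho : A'ᵀ * A' = 1 := (mem_orthogonalGroup_iff' _ _).1 (mem_specialOrthogonalGroup_iff.1 hA').1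
    have e := congrFun (congrFun ho 2) 2
    simp [mul_apply, Fin.sum_univ_three, h02] at e
    nlinarith
  obtain ⟨β, hc, hs⟩ := exists_cos_sin_eq (x := A' 2 2) (y := -A' 1 2) (by nlinarith)
  have hA'' := mul_mem (rotationX_mem β) hA'
  obtain ⟨γ, hγ⟩ := exists_eq_rotationZ hA'' (by simp [mul_apply, Fin.sum_univ_three, rotationX, h02])
    (by simp [mul_apply, Fin.sum_univ_three, rotationX, hc, hs]; ring)
    (by simp [mul_apply, Fin.sum_univ_three, rotationX, hc, hs]; nlinarith)
  refine ⟨-α, -β, γ, ?_⟩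
  rw [← hγ, ← Matrix.mul_assoc (rotationX (-β)), rotationX_neg_mul, Matrix.one_mul, hA'def,
    ← Matrix.mul_assoc, rotationZ_neg_mul, Matrix.one_mul]

section Implement

variable {n : Type*} [Fintype n] [DecidableEq n]

/-- The rotation `A` of the triples `T t`, `t ∈ I`, is implemented by a constant unitary. -/
def IsImplemented (T : ℝ → Fin 3 → Matrix n n ℂ) (I : Set ℝ) (A : Matrix (Fin 3) (Fin 3) ℝ) :
    Prop :=
  ∃ U : Matrix n n ℂ, Uᴴ * U = 1 ∧ ∀ t ∈ I, ∀ i, ∑ j, (A i j : ℂ) • T t j = Uᴴ * T t i * U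

variable {T : ℝ → Fin 3 → Matrix n n ℂ} {I : Set ℝ}

theorem IsImplemented.mul {A A' : Matrix (Fin 3) (Fin 3) ℝ} (h : IsImplemented T I A)
    (h' : IsImplemented T I A') : IsImplemented T I (A * A') := by
  obtain ⟨U, hU, hT⟩ := h
  obtain ⟨U', hU', hT'⟩ := h'
  refine ⟨U * U', ?_, fun t ht i => ?_⟩
  · rw [conjTranspose_mul, Matrix.mul_assoc, ← Matrix.mul_assoc Uᴴ, hU, Matrix.one_mul, hU']
  · calc ∑ j, (((A * A') i j : ℝ) : ℂ) • T t j
        = ∑ k, (A i k : ℂ) • ∑ j, (A' k j : ℂ) • T t j := by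
          simp only [mul_apply, Complex.ofReal_sum, Complex.ofReal_mul, Finset.sum_smul,
            Finset.smul_sum, smul_smul]
          exact Finset.sum_comm
      _ = U'ᴴ * (∑ k, (A i k : ℂ) • T t k) * U' := by
          simp only [hT' t ht, Matrix.mul_sum, Matrix.sum_mul, Matrix.mul_smul, Matrix.smul_mul]
      _ = (U * U')ᴴ * T t i * (U * U') := by
          rw [hT t ht, conjTranspose_mul]
          simp only [Matrix.mul_assoc]

/-- A skew-Hermitian generator implements the rotations about its axis. -/
theorem exists_unitary_of_generator {Y : Matrix n n ℂ} (hY : Yᴴ = -Y) (θ : ℝ) :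
    ∃ U : Matrix n n ℂ, Uᴴ * U = 1 ∧
      (∀ M, Y * M - M * Y = 0 → M = Uᴴ * M * U) ∧
      ∀ M N, Y * M - M * Y = N → Y * N - N * Y = -M →
        Real.cos θ • M + Real.sin θ • N = Uᴴ * M * U := by
  let _ : NormedRing (Matrix n n ℂ) := Matrix.linftyOpNormedRing
  let _ : NormedAlgebra ℝ (Matrix n n ℂ) := Matrix.linftyOpNormedAlgebra
  have hU : (NormedSpace.exp (θ • -Y))ᴴ = NormedSpace.exp (θ • Y) := by
    rw [← Matrix.exp_conjTranspose, conjTranspose_smul, conjTranspose_neg, hY, neg_neg,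
      star_trivial]
  refine ⟨NormedSpace.exp (θ • -Y), ?_, fun M h => ?_, fun M N h h' => ?_⟩
  · have := exp_mul_mul_exp_eq_self (Y := Y) (T := 1) (by simp) θ
    rw [hU]
    rw [mul_one] at this
    exact this.symm
  · rw [hU]; exact exp_mul_mul_exp_eq_self h θ
  · rw [hU]; exact cos_smul_add_sin_smul_eq h h' θ

/-- Generators of a symmetry integrate to the symmetry, by Euler angles. -/
theorem isSphericallySymmetric_of_areGenerators [Nonempty n] {Y : Fin 3 → Matrix n n ℂ}
    (h : AreGenerators Y T I) : IsSphericallySymmetric T I := by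
  obtain ⟨hY, hT⟩ := h
  have hZ : ∀ θ, IsImplemented T I (rotationZ θ) := by
    intro θ
    obtain ⟨U, hU, h1, h2⟩ := exists_unitary_of_generator (hY 2).1 θ
    refine ⟨U, hU, fun t ht i => ?_⟩
    have e0 : Y 2 * T t 0 - T t 0 * Y 2 = T t 1 := by
      rw [hT t ht]; simp [leviCivita]
    have e1 : Y 2 * T t 1 - T t 1 * Y 2 = -T t 0 := by
      rw [hT t ht]; simp [leviCivita]
    have e2 : Y 2 * T t 2 - T t 2 * Y 2 = 0 := by
      rw [hT t ht]; simp [leviCivita]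
    simp only [Complex.coe_smul]
    fin_cases i
    · simpa [Fin.sum_univ_three, rotationZ] using h2 _ _ e0 e1
    · have h3 := h2 (T t 1) (-T t 0) e1 (by
        rw [← e0]; simp only [Matrix.mul_neg, Matrix.neg_mul]; abel)
      simpa [Fin.sum_univ_three, rotationZ, add_comm] using h3
    · simpa [Fin.sum_univ_three, rotationZ] using h1 _ e2
  have hX : ∀ θ, IsImplemented T I (rotationX θ) := by
    intro θ
    obtain ⟨U, hU, h1, h2⟩ := exists_unitary_of_generator (hY 0).1 θ
    refine ⟨U, hU, fun t ht i => ?_⟩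
    have e0 : Y 0 * T t 1 - T t 1 * Y 0 = T t 2 := by
      rw [hT t ht]; simp [leviCivita]
    have e1 : Y 0 * T t 2 - T t 2 * Y 0 = -T t 1 := by
      rw [hT t ht]; simp [leviCivita]
    have e2 : Y 0 * T t 0 - T t 0 * Y 0 = 0 := by
      rw [hT t ht]; simp [leviCivita]
    simp only [Complex.coe_smul]
    fin_cases i
    · simpa [Fin.sum_univ_three, rotationX] using h1 _ e2
    · simpa [Fin.sum_univ_three, rotationX] using h2 _ _ e0 e1
    · have h3 := h2 (T t 2) (-T t 1) e1 (by
        rw [← e0]; simp only [Matrix.mul_neg, Matrix.neg_mul]; abel)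
      simpa [Fin.sum_univ_three, rotationX, add_comm] using h3
  intro A hA
  obtain ⟨α, β, γ, rfl⟩ := exists_eq_rotationZ_mul_rotationX_mul_rotationZ hA
  obtain ⟨U, hU, hT'⟩ := (hZ α).mul ((hX β).mul (hZ γ))
  obtain ⟨c, hc, hcU⟩ := exists_smul_mem_specialUnitaryGroup hU
  refine ⟨c • U, hcU, fun t ht i => ?_⟩
  rw [hT' t ht, conjTranspose_smul, Matrix.smul_mul, Matrix.smul_mul, Matrix.mul_smul, smul_smul,
    hc, one_smul]

end Implement

end Rotations

/-! ### Reduction of symmetric solutions to the ansatz -/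

section Reduction

section Conjugation

variable {n : Type*} [Fintype n] [DecidableEq n] {V : Matrix n n ℂ}

theorem unitary_conj_mul (hV : Vᴴ * V = 1) (A B : Matrix n n ℂ) :
    V * A * Vᴴ * (V * B * Vᴴ) = V * (A * B) * Vᴴ := by
  calc V * A * Vᴴ * (V * B * Vᴴ) = V * A * (Vᴴ * V) * B * Vᴴ := by simp only [Matrix.mul_assoc]
    _ = _ := by rw [hV, Matrix.mul_one, Matrix.mul_assoc V]

theorem IsSu.unitary_conj (hV : Vᴴ * V = 1) {A : Matrix n n ℂ} (hA : IsSu A) :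
    IsSu (V * A * Vᴴ) := by
  refine ⟨?_, ?_⟩
  · rw [conjTranspose_mul, conjTranspose_mul, conjTranspose_conjTranspose, hA.1, Matrix.neg_mul,
      Matrix.mul_neg, Matrix.mul_assoc]
  · rw [trace_mul_comm, ← Matrix.mul_assoc, hV, Matrix.one_mul, hA.2]

theorem IsNahmSolution.unitary_conj (hV : Vᴴ * V = 1) {T : ℝ → Fin 3 → Matrix n n ℂ} {I : Set ℝ}
    (hT : IsNahmSolution T I) : IsNahmSolution (fun t i => V * T t i * Vᴴ) I where
  isOpen := hT.isOpen
  isConnected := hT.isConnected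
  isSu t ht i := (hT.isSu t ht i).unitary_conj hV
  hasDerivAt t ht i a b := by
    have e : ∀ A : Matrix n n ℂ, (V * A * Vᴴ) a b = ∑ c, (∑ d, V a d * A d c) * Vᴴ c b := fun A => by
      simp only [Matrix.mul_apply]
    rw [unitary_conj_mul hV, unitary_conj_mul hV, ← Matrix.sub_mul, ← Matrix.mul_sub]
    refine HasDerivAt.congr_deriv (f := fun s => (V * T s i * Vᴴ) a b) ?_ (e _).symm
    simp only [e]
    exact HasDerivAt.fun_sum fun c _ => (HasDerivAt.fun_sum fun d _ =>
      (hT.hasDerivAt t ht i d c).const_mul (V a d)).mul_const _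

theorem AreGenerators.unitary_conj (hV : Vᴴ * V = 1) {Y : Fin 3 → Matrix n n ℂ}
    {T : ℝ → Fin 3 → Matrix n n ℂ} {I : Set ℝ} (h : AreGenerators Y T I) :
    AreGenerators (fun i => V * Y i * Vᴴ) (fun t i => V * T t i * Vᴴ) I := by
  refine ⟨fun i => (h.1 i).unitary_conj hV, fun t ht i j => ?_⟩
  rw [unitary_conj_mul hV, unitary_conj_mul hV, ← Matrix.sub_mul, ← Matrix.mul_sub, h.2 t ht]
  simp only [Matrix.mul_sum, Matrix.sum_mul, Matrix.mul_smul, Matrix.smul_mul]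

end Conjugation

section Coefficients

variable {B₃ : Fin 3 → Matrix (Fin 5) (Fin 3) ℂ} {B₁ : Fin 3 → Matrix (Fin 3) (Fin 1) ℂ}

theorem complexAnsatz_apply_five (f₁ f₂ : ℝ) (g₀ g₁ : ℂ) :
    complexAnsatz B₃ B₁ f₁ f₂ g₀ g₁ 2 (.inl 0) (.inl 0) = -2 * Complex.I * f₂ := by
  change (f₂ : ℂ) * irrep 5 2 0 0 = _
  simp [irrep_five_two]
  ring

theorem complexAnsatz_apply_three (f₁ f₂ : ℝ) (g₀ g₁ : ℂ) :
    complexAnsatz B₃ B₁ f₁ f₂ g₀ g₁ 2 (.inr (.inl 0)) (.inr (.inl 0)) = -Complex.I * f₁ := by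
  change (f₁ : ℂ) * irrep 3 2 0 0 = _
  simp [irrep_three_two]
  ring

/-- The coefficients of a generated solution satisfy the system, with complex `g₀` and `g₁`. -/
theorem exists_hasDerivAt_coeff (h₃ : IsInvariantTriple 3 B₃) (h₁ : IsInvariantTriple 1 B₁)
    {S : ℝ → Fin 3 → Matrix Idx531 Idx531 ℂ} {I : Set ℝ} (hS : IsNahmSolution S I)
    (hE : ∀ t ∈ I, IsEquivariant531 (S t)) : ∃ (f₁ f₂ : ℝ → ℝ) (g₀ g₁ : ℝ → ℂ),
    (∀ t ∈ I, S t = complexAnsatz B₃ B₁ (f₁ t) (f₂ t) (g₀ t) (g₁ t)) ∧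
    ∀ t ∈ I,
      HasDerivAt f₁ (f₁ t ^ 2 + Complex.normSq (g₀ t) - 5 / 6 * Complex.normSq (g₁ t)) t ∧
      HasDerivAt f₂ (f₂ t ^ 2 + 1 / 2 * Complex.normSq (g₁ t)) t ∧
      HasDerivAt g₀ (((2 * f₁ t : ℝ) : ℂ) * g₀ t) t ∧
      HasDerivAt g₁ (((3 * f₂ t - f₁ t : ℝ) : ℂ) * g₁ t) t := by
  have hS' := fun t (ht : t ∈ I) =>
    exists_eq_complexAnsatz h₃ h₁ (fun i => (hS.isSu t ht i).1) (hE t ht)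
  refine ⟨_, _, _, _, hS', fun t ht => ?_⟩
  have hd := fun a b => hS.hasDerivAt t ht 2 a b
  rw [hS' t ht, complexAnsatz_commutator h₃ h₁] at hd
  have b3 := h₃.apply_two_one_zero_ne_zero₃
  have b1 := h₁.apply_two_one_zero_ne_zero₁
  refine ⟨?_, ?_, ?_, ?_⟩
  · refine (Complex.reCLM.hasFDerivAt.comp_hasDerivAt t
      ((hd (.inr (.inl 0)) (.inr (.inl 0))).const_mul Complex.I)).congr_deriv ?_
    rw [complexAnsatz_apply_three, neg_mul, mul_neg, ← mul_assoc, Complex.I_mul_I, neg_one_mul,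
      neg_neg, Complex.reCLM_apply, Complex.ofReal_re]
  · refine (Complex.reCLM.hasFDerivAt.comp_hasDerivAt t
      ((hd (.inl 0) (.inl 0)).const_mul (Complex.I / 2))).congr_deriv ?_
    rw [complexAnsatz_apply_five, Complex.reCLM_apply]
    have : ∀ x : ℂ, Complex.I / 2 * (-2 * Complex.I * x) = x := fun x => by
      linear_combination (-x) * Complex.I_mul_I
    rw [this, Complex.ofReal_re]
  · refine ((hd (.inr (.inl 1)) (.inr (.inr 0))).div_const (B₁ 2 1 0)).congr_deriv ?_
    change (_ * B₁ 2 1 0) / _ = _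
    rw [mul_div_cancel_right₀ _ b1]
    push_cast
    rfl
  · refine ((hd (.inl 1) (.inr (.inl 0))).div_const (B₃ 2 1 0)).congr_deriv ?_
    change (_ * B₃ 2 1 0) / _ = _
    rw [mul_div_cancel_right₀ _ b3]
    push_cast
    rfl

end Coefficients

theorem IsSolution531.analyticOnNhd {f₁ f₂ g₀ g₁ : ℝ → ℝ} {I : Set ℝ} (hI : IsOpen I)
    (h : IsSolution531 f₁ f₂ g₀ g₁ I) : AnalyticOnNhd ℝ f₁ I ∧ AnalyticOnNhd ℝ f₂ I ∧
      AnalyticOnNhd ℝ g₀ I ∧ AnalyticOnNhd ℝ g₁ I := by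
  let q : Fin 4 → Fin 4 → Fin 4 → ℝ :=
    ![!![1, 0, 0, 0; 0, 0, 0, 0; 0, 0, 1, 0; 0, 0, 0, -(5 / 6)],
      !![0, 0, 0, 0; 0, 1, 0, 0; 0, 0, 0, 0; 0, 0, 0, 1 / 2],
      !![0, 0, 2, 0; 0, 0, 0, 0; 0, 0, 0, 0; 0, 0, 0, 0],
      !![0, 0, 0, -1; 0, 0, 0, 3; 0, 0, 0, 0; 0, 0, 0, 0]]
  have hx : ∀ t ∈ I, ∀ i, HasDerivAt (![f₁, f₂, g₀, g₁] i)
      (∑ j, ∑ k, q i j k * (![f₁, f₂, g₀, g₁] j t * ![f₁, f₂, g₀, g₁] k t)) t := by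
    intro t ht i
    obtain ⟨h1, h2, h3, h4⟩ := h t ht
    fin_cases i
    · exact h1.congr_deriv (by simp [q, Fin.sum_univ_four]; ring)
    · exact h2.congr_deriv (by simp [q, Fin.sum_univ_four]; ring)
    · exact h3.congr_deriv (by simp [q, Fin.sum_univ_four]; ring)
    · exact h4.congr_deriv (by simp [q, Fin.sum_univ_four]; ring)
  have ha := analyticOnNhd_of_quadratic hI hx
  exact ⟨ha 0, ha 1, ha 2, ha 3⟩

/-- The diagonal unitary that acts by a scalar on each of `V₅`, `V₃`, `V₁`. -/
def blockPhase (v w : ℂ) : Matrix Idx531 Idx531 ℂ :=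
  blockMatrix 1 0 0 0 (v • 1) 0 0 0 (w • 1)

theorem conjTranspose_blockPhase (v w : ℂ) :
    (blockPhase v w)ᴴ = blockPhase (star v) (star w) := by
  simp [blockPhase, blockMatrix_conjTranspose]

theorem conjTranspose_blockPhase_mul {v w : ℂ} (hv : star v * v = 1) (hw : star w * w = 1) :
    (blockPhase v w)ᴴ * blockPhase v w = 1 := by
  rw [conjTranspose_blockPhase, ← blockMatrix_one]
  simp only [blockPhase, blockMatrix_mul, Matrix.mul_smul, Matrix.mul_zero,
    Matrix.mul_one, smul_zero, add_zero, zero_add, smul_smul]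
  rw [mul_comm v, mul_comm w, hv, hw, one_smul, one_smul]

theorem blockPhase_mul_rep531_mul {v w : ℂ} (hv : star v * v = 1) (i : Fin 3) :
    blockPhase v w * rep531 i * (blockPhase v w)ᴴ = rep531 i := by
  rw [conjTranspose_blockPhase, rep531_eq_blockMatrix]
  simp only [blockPhase, blockMatrix_mul, Matrix.mul_smul, Matrix.smul_mul, Matrix.mul_zero,
    Matrix.zero_mul, Matrix.mul_one, Matrix.one_mul, smul_zero, add_zero, zero_add, smul_smul]
  rw [hv, one_smul]

/-- A block phase removes the phases of the off-diagonal coefficients. -/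
theorem blockPhase_mul_complexAnsatz_mul {v w : ℂ} (hv : star v * v = 1) (hw : star w * w = 1)
    (B₃ : Fin 3 → Matrix (Fin 5) (Fin 3) ℂ) (B₁ : Fin 3 → Matrix (Fin 3) (Fin 1) ℂ)
    (f₁ f₂ r₀ r₁ : ℝ) (i : Fin 3) :
    blockPhase v (v * w) * complexAnsatz B₃ B₁ f₁ f₂ (w * r₀) (v * r₁) i *
      (blockPhase v (v * w))ᴴ = ansatz531 B₃ B₁ f₁ f₂ r₀ r₁ i := by
  rw [conjTranspose_blockPhase, ansatz531_eq_complexAnsatz]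
  simp only [blockPhase, complexAnsatz, blockMatrix_mul, Matrix.mul_smul, Matrix.smul_mul,
    Matrix.mul_zero, Matrix.zero_mul, Matrix.mul_one, Matrix.one_mul, smul_zero, add_zero,
    zero_add, smul_smul, Matrix.mul_neg, smul_neg, neg_zero, blockMatrix_inj,
    star_mul', RCLike.star_def, Complex.conj_ofReal, and_true, true_and]
  rw [RCLike.star_def] at hv hw
  refine ⟨?_, ⟨?_, ?_, ?_⟩, ?_⟩
  · congr 1; linear_combination (r₁ : ℂ) * hv
  · congr 2; linear_combination (r₁ : ℂ) * hv
  · congr 1; linear_combination (f₁ : ℂ) * hv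
  · congr 1; linear_combination (r₀ : ℂ) * hv * (starRingEnd ℂ w * w) + r₀ * hw
  · congr 2; linear_combination (r₀ : ℂ) * hv * (starRingEnd ℂ w * w) + r₀ * hw

/-- Up to a constant unitary, a solution generated by `V₅ ⊕ V₃ ⊕ V₁` is given by real analytic
solutions of the reduced system. -/
theorem exists_ansatz531_of_areGenerators {B₃ : Fin 3 → Matrix (Fin 5) (Fin 3) ℂ}
    {B₁ : Fin 3 → Matrix (Fin 3) (Fin 1) ℂ} (h₃ : IsInvariantTriple 3 B₃)
    (h₁ : IsInvariantTriple 1 B₁) {I : Set ℝ} {T : ℝ → Fin 3 → Matrix Idx531 Idx531 ℂ}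
    {Y : Fin 3 → Matrix Idx531 Idx531 ℂ} (hT : IsNahmSolution T I) (hY : AreGenerators Y T I)
    (hiso : RepIso Y rep531) :
    ∃ U ∈ Matrix.specialUnitaryGroup Idx531 ℂ, (∀ i, U * Y i * Uᴴ = rep531 i) ∧
      ∃ f₁ f₂ g₀ g₁ : ℝ → ℝ,
        AnalyticOnNhd ℝ f₁ I ∧ AnalyticOnNhd ℝ f₂ I ∧
        AnalyticOnNhd ℝ g₀ I ∧ AnalyticOnNhd ℝ g₁ I ∧
        (∀ t ∈ I, ∀ i, U * T t i * Uᴴ = ansatz531 B₃ B₁ (f₁ t) (f₂ t) (g₀ t) (g₁ t) i) ∧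
        IsSolution531 f₁ f₂ g₀ g₁ I := by
  obtain ⟨V, hV, hV', hVY⟩ := hiso.exists_unitary (fun i => (hY.1 i).1) conjTranspose_rep531
  have hVY' : ∀ i, V * Y i * Vᴴ = rep531 i := fun i => by
    rw [hVY, Matrix.mul_assoc, hV', Matrix.mul_one]
  have hE : ∀ t ∈ I, IsEquivariant531 fun i => V * T t i * Vᴴ := by
    have h := (hY.unitary_conj hV).2
    simp only [hVY'] at h
    exact h
  obtain ⟨f₁, f₂, g₀, g₁, hS, hd⟩ := exists_hasDerivAt_coeff h₃ h₁ (hT.unitary_conj hV) hE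
  have c1 : ContinuousOn f₁ I := fun t ht => (hd t ht).1.continuousAt.continuousWithinAt
  have c2 : ContinuousOn f₂ I := fun t ht => (hd t ht).2.1.continuousAt.continuousWithinAt
  obtain ⟨w, hw, r₀, hr₀, hr₀'⟩ := exists_eq_phase_mul_of_hasDerivAt hT.isOpen hT.isConnected
    (continuousOn_const.mul c1) (fun t ht => (hd t ht).2.2.1)
  obtain ⟨v, hv, r₁, hr₁, hr₁'⟩ := exists_eq_phase_mul_of_hasDerivAt hT.isOpen hT.isConnected
    ((continuousOn_const.mul c2).sub c1) (fun t ht => (hd t ht).2.2.2)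
  have hsq : ∀ {u : ℂ}, star u * u = 1 → ∀ r : ℝ, Complex.normSq (u * r) = r ^ 2 := by
    intro u hu r
    have : Complex.normSq u = 1 := by
      have h := Complex.normSq_eq_conj_mul_self (z := u)
      rw [← RCLike.star_def, hu] at h
      exact_mod_cast h
    rw [Complex.normSq_mul, this, Complex.normSq_ofReal, one_mul, sq]
  have hsol : IsSolution531 f₁ f₂ r₀ r₁ I := fun t ht => by
    obtain ⟨d1, d2, -, -⟩ := hd t ht
    rw [hr₀ t ht, hr₁ t ht, hsq hw, hsq hv] at d1
    rw [hr₁ t ht, hsq hv] at d2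
    exact ⟨d1, d2, hr₀' t ht, hr₁' t ht⟩
  have hvw : star (v * w) * (v * w) = 1 := by
    rw [star_mul']
    linear_combination hv * (star w * w) + hw
  set D := blockPhase v (v * w) with hD
  have hDV : (D * V)ᴴ * (D * V) = 1 := by
    rw [conjTranspose_mul, Matrix.mul_assoc, ← Matrix.mul_assoc Dᴴ,
      conjTranspose_blockPhase_mul hv hvw, Matrix.one_mul, hV]
  obtain ⟨c, hc, hcU⟩ := exists_smul_mem_specialUnitaryGroup hDV
  have hconj : ∀ A, c • (D * V) * A * (c • (D * V))ᴴ = D * (V * A * Vᴴ) * Dᴴ := by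
    intro A
    rw [conjTranspose_smul, Matrix.smul_mul, Matrix.smul_mul, Matrix.mul_smul, smul_smul,
      mul_comm c, hc, one_smul, conjTranspose_mul]
    simp only [Matrix.mul_assoc]
  obtain ⟨a1, a2, a3, a4⟩ := hsol.analyticOnNhd hT.isOpen
  refine ⟨c • (D * V), hcU, fun i => ?_, f₁, f₂, r₀, r₁, a1, a2, a3, a4, fun t ht i => ?_, hsol⟩
  · rw [hconj, hVY', blockPhase_mul_rep531_mul hv]
  · rw [hconj, congrFun (hS t ht) i, hr₀ t ht, hr₁ t ht, blockPhase_mul_complexAnsatz_mul hv hw]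

end Reduction

/-! ### The explicit solution -/

section ExplicitSolution

theorem sq_sub_one_neg {t : ℝ} (ht : t ∈ Ioo (-1 : ℝ) 1) : t ^ 2 - 1 < 0 := by
  nlinarith [ht.1, ht.2]

theorem isSolution531_sol : IsSolution531 solF solF solG₀ solG₁ (Ioo (-1) 1) := by
  intro t ht
  have hd : t ^ 2 - 1 ≠ 0 := (sq_sub_one_neg ht).ne
  have h2 : √2 ^ 2 = 2 := Real.sq_sqrt (by norm_num)
  have h3 : √3 ^ 2 = 3 := Real.sq_sqrt (by norm_num)
  have h8 : √8 ^ 2 = 8 := Real.sq_sqrt (by norm_num)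
  have hs3 : √3 ≠ 0 := by positivity
  have hp : HasDerivAt (fun s : ℝ => s ^ 2 - 1) (2 * t) t := by
    simpa using (hasDerivAt_pow 2 t).sub_const 1
  have hF : HasDerivAt solF ((t ^ 2 + 1) / (t ^ 2 - 1) ^ 2) t := by
    refine (((hasDerivAt_id t).div hp hd).neg).congr_deriv ?_
    rw [← neg_div]
    congr 1
    simp only [id]
    ring
  have hG₀ : solG₀ t ^ 2 = 8 / 3 / (t ^ 2 - 1) ^ 2 := by
    rw [solG₀, div_pow, mul_pow, h8, h3, div_div]
  have hG₁ : solG₁ t ^ 2 = 2 / (t ^ 2 - 1) ^ 2 := by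
    rw [solG₁, div_pow, h2]
  refine ⟨hF.congr_deriv ?_, hF.congr_deriv ?_, ?_, ?_⟩
  · rw [hG₀, hG₁, solF]
    field_simp
    ring
  · rw [hG₁, solF]
    field_simp
  · refine ((hasDerivAt_const t √8).div (hp.const_mul √3) (by positivity)).congr_deriv ?_
    rw [solF, solG₀]
    field_simp
    ring
  · refine ((hasDerivAt_const t √2).div hp hd).congr_deriv ?_
    rw [solF, solG₁]
    field_simp
    ring

/-- A continuous function that agrees with `solF` on `(-1, 1)` cannot be defined at `±1`. -/
theorem eq_Ioo_of_continuousAt {J : Set ℝ} (hJ : IsConnected J) (hsub : Ioo (-1) 1 ⊆ J)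
    {F : ℝ → ℝ} (hF : ∀ t ∈ J, ContinuousAt F t) (h : ∀ t ∈ Ioo (-1 : ℝ) 1, F t = solF t) :
    J = Ioo (-1) 1 := by
  have hord : J.OrdConnected := hJ.isPreconnected.ordConnected
  have h0 : (0 : ℝ) ∈ J := hsub (by norm_num)
  have key : ∀ s ∈ closure (Ioo (-1 : ℝ) 1), s ^ 2 = 1 → s ∉ J := by
    intro s hs hs1 hsJ
    have hc : ContinuousAt (fun t => (t ^ 2 - 1) * F t + t) s :=
      (((continuousAt_id.pow 2).sub continuousAt_const).mul (hF s hsJ)).add continuousAt_id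
    have : (𝓝[Ioo (-1 : ℝ) 1] s).NeBot := mem_closure_iff_nhdsWithin_neBot.1 hs
    have h1 := hc.tendsto.mono_left (nhdsWithin_le_nhds (s := Ioo (-1 : ℝ) 1))
    have h2 : Tendsto (fun t => (t ^ 2 - 1) * F t + t) (𝓝[Ioo (-1 : ℝ) 1] s) (𝓝 0) := by
      refine tendsto_const_nhds.congr' ?_
      filter_upwards [self_mem_nhdsWithin] with t ht
      have hd : t ^ 2 - 1 ≠ 0 := (sq_sub_one_neg ht).ne
      rw [h t ht, solF, mul_neg, mul_div_cancel₀ _ hd, neg_add_cancel]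
    have h3 := tendsto_nhds_unique h1 h2
    rw [hs1, sub_self, zero_mul, zero_add] at h3
    rw [h3] at hs1
    norm_num at hs1
  rw [closure_Ioo (by norm_num)] at key
  refine Subset.antisymm (fun t ht => ⟨?_, ?_⟩) hsub
  · by_contra hlt
    exact key (-1) (by norm_num) (by norm_num)
      (hord.out ht h0 ⟨not_lt.1 hlt, by norm_num⟩)
  · by_contra hlt
    exact key 1 (by norm_num) (by norm_num)
      (hord.out h0 ht ⟨by norm_num, not_lt.1 hlt⟩)

theorem isMaximalSolution531_sol : IsMaximalSolution531 solF solF solG₀ solG₁ (Ioo (-1) 1) :=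
  ⟨isSolution531_sol, fun _ _ _ _ _ _ hJ hsol hsub h =>
    eq_Ioo_of_continuousAt hJ hsub (fun t ht => (hsol t ht).1.continuousAt) fun t ht => (h t ht).1⟩

section Residues

/-- Partial fractions for a denominator `t ^ 2 - 1`. -/
theorem hasResidueAt_div_sq_sub_one (a b : ℝ) {s : ℝ} (hs : s ^ 2 = 1) :
    HasResidueAt (fun t => (a * t + b) / (t ^ 2 - 1)) s ((a + b * s) / 2) := by
  have hs0 : s + s ≠ 0 := by
    intro h
    have : s = 0 := by linarith
    rw [this] at hs
    norm_num at hs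
  refine ⟨fun t => (a - b * s) / 2 * (t + s)⁻¹,
    analyticAt_const.mul ((analyticAt_id.add analyticAt_const).inv hs0), ?_⟩
  have hne : ∀ᶠ t in 𝓝[≠] s, t + s ≠ 0 :=
    nhdsWithin_le_nhds ((continuousAt_id.add continuousAt_const).eventually_ne hs0)
  filter_upwards [hne, self_mem_nhdsWithin] with t ht hts
  have hts' : t - s ≠ 0 := sub_ne_zero.2 hts
  have hd : t ^ 2 - 1 = (t - s) * (t + s) := by rw [← hs]; ring
  rw [hd, smul_eq_mul]
  field_simp
  linear_combination (-2 * b) * hs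

variable {s : ℝ} (hs : s ^ 2 = 1)
include hs

theorem hasResidueAt_solF : HasResidueAt solF s (-(1 / 2)) := by
  have h := hasResidueAt_div_sq_sub_one (-1) 0 hs
  have e : (fun t => (-1 * t + 0) / (t ^ 2 - 1)) = solF := by
    funext t
    rw [solF]
    ring
  rw [e] at h
  convert h using 1
  ring

theorem hasResidueAt_solG₀ : HasResidueAt solG₀ s (s * √(2 / 3)) := by
  have h := hasResidueAt_div_sq_sub_one 0 (√8 / √3) hs
  have e : (fun t => (0 * t + √8 / √3) / (t ^ 2 - 1)) = solG₀ := by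
    funext t
    rw [solG₀, zero_mul, zero_add, div_div]
  rw [e] at h
  convert h using 1
  have h8 : √8 = 2 * √2 := by
    rw [show (8 : ℝ) = 2 ^ 2 * 2 by norm_num, Real.sqrt_mul (by norm_num), Real.sqrt_sq (by norm_num)]
  rw [h8, Real.sqrt_div (by norm_num)]
  ring

theorem hasResidueAt_solG₁ : HasResidueAt solG₁ s (s * (1 / √2)) := by
  have h := hasResidueAt_div_sq_sub_one 0 √2 hs
  have e : (fun t => (0 * t + √2) / (t ^ 2 - 1)) = solG₁ := by
    funext t
    rw [solG₁, zero_mul, zero_add]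
  rw [e] at h
  convert h using 1
  have h2 : √2 ^ 2 = 2 := Real.sq_sqrt (by norm_num)
  field_simp
  linear_combination (-s) * h2

end Residues

theorem HasResidueAt.ofReal_mul {f : ℝ → ℝ} {t₀ r : ℝ} (hf : HasResidueAt f t₀ r) (c : ℂ) :
    HasResidueAt (fun t => (f t : ℂ) * c) t₀ (r * c) := by
  obtain ⟨h, hh, hfh⟩ := hf
  refine ⟨fun t => (h t : ℂ) * c,
    ((Complex.ofRealCLM.analyticAt _).comp hh).mul analyticAt_const, ?_⟩
  filter_upwards [hfh] with t ht
  rw [ht, smul_eq_mul, Complex.real_smul]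
  push_cast
  ring

theorem HasResidueAt.add {E : Type*} [NormedAddCommGroup E] [NormedSpace ℝ E] {f g : ℝ → E}
    {t₀ : ℝ} {r r' : E} (hf : HasResidueAt f t₀ r) (hg : HasResidueAt g t₀ r') :
    HasResidueAt (fun t => f t + g t) t₀ (r + r') := by
  obtain ⟨h, hh, hfh⟩ := hf
  obtain ⟨k, hk, hgk⟩ := hg
  refine ⟨fun t => h t + k t, hh.add hk, ?_⟩
  filter_upwards [hfh, hgk] with t ht ht'
  rw [ht, ht', smul_add]
  abel

section Datum

variable {B₃ : Fin 3 → Matrix (Fin 5) (Fin 3) ℂ} {B₁ : Fin 3 → Matrix (Fin 3) (Fin 1) ℂ}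

theorem ansatz531_eq_add (f g₀ g₁ : ℝ) (i : Fin 3) :
    ansatz531 B₃ B₁ f f g₀ g₁ i = (f : ℂ) • rep531 i + (g₀ : ℂ) • ansatz531 B₃ B₁ 0 0 1 0 i +
      (g₁ : ℂ) • ansatz531 B₃ B₁ 0 0 0 1 i := by
  simp only [ansatz531_eq_complexAnsatz, rep531_eq_blockMatrix, complexAnsatz, blockMatrix_smul,
    blockMatrix_add, blockMatrix_inj]
  simp

theorem hasResidueAt_ansatz531 {f g₀ g₁ : ℝ → ℝ} {t₀ r r₀ r₁ : ℝ} (hf : HasResidueAt f t₀ r)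
    (h₀ : HasResidueAt g₀ t₀ r₀) (h₁ : HasResidueAt g₁ t₀ r₁) (i : Fin 3) (a b : Idx531) :
    HasResidueAt (fun t => ansatz531 B₃ B₁ (f t) (f t) (g₀ t) (g₁ t) i a b) t₀
      (ansatz531 B₃ B₁ r r r₀ r₁ i a b) := by
  have e : ∀ f g₀ g₁ : ℝ, ansatz531 B₃ B₁ f f g₀ g₁ i a b = f * rep531 i a b +
      g₀ * ansatz531 B₃ B₁ 0 0 1 0 i a b + g₁ * ansatz531 B₃ B₁ 0 0 0 1 i a b := fun f g₀ g₁ => by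
    rw [ansatz531_eq_add]
    rfl
  rw [e]
  rw [funext fun t => e (f t) (g₀ t) (g₁ t)]
  exact ((hf.ofReal_mul _).add (h₀.ofReal_mul _)).add (h₁.ofReal_mul _)

theorem hasDerivAt_ansatz531 {f₁ f₂ g₀ g₁ : ℝ → ℝ} {f₁' f₂' g₀' g₁' t : ℝ}
    (h1 : HasDerivAt f₁ f₁' t) (h2 : HasDerivAt f₂ f₂' t) (h3 : HasDerivAt g₀ g₀' t)
    (h4 : HasDerivAt g₁ g₁' t) (i : Fin 3) (a b : Idx531) :
    HasDerivAt (fun s => ansatz531 B₃ B₁ (f₁ s) (f₂ s) (g₀ s) (g₁ s) i a b)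
      (ansatz531 B₃ B₁ f₁' f₂' g₀' g₁' i a b) t := by
  rcases a with a | a | a <;> rcases b with b | b | b
  · exact h2.ofReal_comp.mul_const _
  · exact h4.ofReal_comp.mul_const _
  · exact hasDerivAt_const _ _
  · exact (h4.ofReal_comp.mul_const _).neg
  · exact h1.ofReal_comp.mul_const _
  · exact h3.ofReal_comp.mul_const _
  · exact hasDerivAt_const _ _
  · exact (h3.ofReal_comp.mul_const _).neg
  · exact hasDerivAt_const _ _

theorem IsSolution531.isNahmSolution (h₃ : IsInvariantTriple 3 B₃) (h₁ : IsInvariantTriple 1 B₁)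
    {f₁ f₂ g₀ g₁ : ℝ → ℝ} {I : Set ℝ} (hI : IsOpen I) (hI' : IsConnected I)
    (h : IsSolution531 f₁ f₂ g₀ g₁ I) :
    IsNahmSolution (fun t => ansatz531 B₃ B₁ (f₁ t) (f₂ t) (g₀ t) (g₁ t)) I where
  isOpen := hI
  isConnected := hI'
  isSu t _ i := by
    rw [ansatz531_eq_complexAnsatz]
    exact isSu_complexAnsatz _ _ _ _ i
  hasDerivAt t ht i a b := by
    obtain ⟨d1, d2, d3, d4⟩ := h t ht
    refine (hasDerivAt_ansatz531 d1 d2 d3 d4 i a b).congr_deriv ?_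
    simp only [ansatz531_eq_complexAnsatz]
    rw [complexAnsatz_commutator h₃ h₁]
    simp only [Complex.normSq_ofReal, ← sq]
    push_cast
    rfl

theorem areGenerators_ansatz531 (h₃ : IsInvariantTriple 3 B₃) (h₁ : IsInvariantTriple 1 B₁)
    (f₁ f₂ g₀ g₁ : ℝ → ℝ) (I : Set ℝ) :
    AreGenerators rep531 (fun t => ansatz531 B₃ B₁ (f₁ t) (f₂ t) (g₀ t) (g₁ t)) I := by
  refine ⟨isSu_rep531, fun t _ i j => ?_⟩
  simp only [ansatz531_eq_complexAnsatz]
  exact isEquivariant531_complexAnsatz h₃ h₁ _ _ _ _ i j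

theorem isMaximalNahmSolution_sol (h₃ : IsInvariantTriple 3 B₃) (h₁ : IsInvariantTriple 1 B₁) :
    IsMaximalNahmSolution (fun t => ansatz531 B₃ B₁ (solF t) (solF t) (solG₀ t) (solG₁ t))
      (Ioo (-1) 1) := by
  refine ⟨isSolution531_sol.isNahmSolution h₃ h₁ isOpen_Ioo (isConnected_Ioo (by norm_num)),
    fun J S hS hsub h => ?_⟩
  refine eq_Ioo_of_continuousAt hS.isConnected hsub
    (F := fun t => (Complex.I / 2 * S t 2 (.inl 0) (.inl 0)).re) (fun t ht => ?_) fun t ht => ?_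
  · exact Complex.continuous_re.continuousAt.comp
      (continuousAt_const.mul (hS.hasDerivAt t ht 2 _ _).continuousAt)
  · have e : Complex.I / 2 * (-2 * Complex.I * solF t) = (solF t : ℂ) := by
      linear_combination (-(solF t : ℂ)) * Complex.I_mul_I
    have h' : S t 2 = ansatz531 B₃ B₁ (solF t) (solF t) (solG₀ t) (solG₁ t) 2 :=
      congrFun (h t ht) 2
    rw [h', ansatz531_eq_complexAnsatz, complexAnsatz_apply_five, e, Complex.ofReal_re]

end Datum

section Irreducible

variable {n : Type*} [Fintype n] [DecidableEq n]

/-- A subspace that is invariant under a diagonal matrix with distinct entries contains the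
components of its vectors. -/
theorem single_mem_of_diagonal {W : Submodule ℂ (n → ℂ)} {d : n → ℂ} (hd : Function.Injective d)
    (hW : ∀ v ∈ W, diagonal d *ᵥ v ∈ W) {v : n → ℂ} (hv : v ∈ W) {a : n} (ha : v a ≠ 0) :
    Pi.single a 1 ∈ W := by
  have key : ∀ s : Finset n, (fun c => (∏ b ∈ s, (d c - d b)) * v c) ∈ W := by
    intro s
    induction s using Finset.induction_on with
    | empty => simpa using hv
    | insert b s hb ih =>
      have h := W.sub_mem (hW _ ih) (W.smul_mem (d b) ih)
      convert h using 1
      funext c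
      rw [Finset.prod_insert hb, Pi.sub_apply, mulVec_diagonal, Pi.smul_apply, smul_eq_mul]
      ring
  set p := (∏ b ∈ Finset.univ.erase a, (d a - d b)) * v a with hp
  have hp0 : p ≠ 0 := mul_ne_zero (Finset.prod_ne_zero_iff.2 fun b hb =>
    sub_ne_zero.2 fun h => Finset.ne_of_mem_erase hb (hd h).symm) ha
  have h := W.smul_mem p⁻¹ (key (Finset.univ.erase a))
  convert h using 1
  funext c
  rw [Pi.smul_apply, smul_eq_mul]
  by_cases hc : c = a
  · subst hc
    rw [Pi.single_eq_same, ← hp, inv_mul_cancel₀ hp0]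
  · rw [Pi.single_eq_of_ne hc, Finset.prod_eq_zero (Finset.mem_erase.2 ⟨hc, Finset.mem_univ c⟩)
      (sub_self _), zero_mul, mul_zero]

theorem sum_rep531_mul_self : ∑ k, rep531 k * rep531 k =
    blockMatrix ((-6 : ℂ) • 1) 0 0 0 ((-2 : ℂ) • 1) 0 0 0 0 := by
  rw [← sum_irrep_five_mul_self, ← sum_irrep_three_mul_self]
  simp only [rep531_eq_blockMatrix, blockMatrix_mul, Fin.sum_univ_three, blockMatrix_add,
    blockMatrix_inj]
  simp

/-- The operator `10 · ∑ Yₖ² - √-1 Y₃` on `V₅ ⊕ V₃ ⊕ V₁` separates the weight vectors. -/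
theorem exists_diagonal_eq : ∃ d : Idx531 → ℂ, Function.Injective d ∧
    (10 : ℂ) • ∑ k, rep531 k * rep531 k - Complex.I • rep531 2 = diagonal d := by
  refine ⟨Sum.elim ![-62, -61, -60, -59, -58] (Sum.elim ![-21, -20, -19] ![0]), ?_, ?_⟩
  · rintro (a | a | a) (b | b | b) <;> fin_cases a <;> fin_cases b <;> simp
  · rw [sum_rep531_mul_self, rep531_eq_blockMatrix, irrep_five_two, irrep_three_two]
    ext (a | a | a) (b | b | b) <;> fin_cases a <;> fin_cases b <;>
      simp [blockMatrix] <;> norm_num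
    · linear_combination 2 * Complex.I_mul_I
    · linear_combination (-2) * Complex.I_mul_I

variable {B₃ : Fin 3 → Matrix (Fin 5) (Fin 3) ℂ} {B₁ : Fin 3 → Matrix (Fin 3) (Fin 1) ℂ}

/-- The edges below connect all coordinates of `V₅ ⊕ V₃ ⊕ V₁`. -/
theorem forall_of_iff {P : Idx531 → Prop} (e1 : P (.inl 0) ↔ P (.inl 1))
    (e2 : P (.inl 1) ↔ P (.inl 2)) (e3 : P (.inl 2) ↔ P (.inl 3)) (e4 : P (.inl 3) ↔ P (.inl 4))
    (e5 : P (.inr (.inl 0)) ↔ P (.inr (.inl 1))) (e6 : P (.inr (.inl 1)) ↔ P (.inr (.inl 2)))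
    (e7 : P (.inl 1) ↔ P (.inr (.inl 0))) (e8 : P (.inr (.inl 1)) ↔ P (.inr (.inr 0)))
    {a : Idx531} (ha : P a) (b : Idx531) : P b := by
  have p2 := e1.trans e2
  have p3 := p2.trans e3
  have q0 := e1.trans e7
  have q1 := q0.trans e5
  have h : ∀ b, P (.inl 0) ↔ P b := by
    rintro (b | b | b) <;> fin_cases b
    exacts [Iff.rfl, e1, p2, p3, p3.trans e4, q0, q1, q1.trans e6, q1.trans e8]
  exact (h b).1 ((h a).2 ha)

/-- The values at `0` and `1/2` recover the generators; these separate the weight vectors, and the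
matrix entries connect all of them. -/
theorem isIrreducibleDatum_sol (h₃ : IsInvariantTriple 3 B₃) (h₁ : IsInvariantTriple 1 B₁) :
    IsIrreducibleDatum (fun t => ansatz531 B₃ B₁ (solF t) (solF t) (solG₀ t) (solG₁ t))
      (Ioo (-1) 1) := by
  intro W hW
  rw [or_iff_not_imp_left]
  intro hbot
  obtain ⟨v, hv, hv0⟩ := Submodule.exists_mem_ne_zero_of_ne_bot hbot
  have h0 : ∀ i, ∀ v ∈ W, ansatz531 B₃ B₁ 0 0 (solG₀ 0) (solG₁ 0) i *ᵥ v ∈ W := by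
    intro i v hv
    have h : ansatz531 B₃ B₁ (solF 0) (solF 0) (solG₀ 0) (solG₁ 0) i *ᵥ v ∈ W :=
      hW 0 (by norm_num) i v hv
    have e : solF 0 = 0 := by simp [solF]
    rwa [e] at h
  have hrep : ∀ i, ∀ v ∈ W, rep531 i *ᵥ v ∈ W := by
    intro i v hv
    have h := W.sub_mem (W.smul_mem (3 / 2) (hW (1 / 2) (by norm_num) i v hv))
      (W.smul_mem 2 (h0 i v hv))
    have e : rep531 i = (3 / 2 : ℂ) • ansatz531 B₃ B₁ (solF (1 / 2)) (solF (1 / 2))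
        (solG₀ (1 / 2)) (solG₁ (1 / 2)) i -
        (2 : ℂ) • ansatz531 B₃ B₁ 0 0 (solG₀ 0) (solG₁ 0) i := by
      have e0 : solF (1 / 2) = 2 / 3 := by norm_num [solF]
      have e1 : solG₀ (1 / 2) = 4 / 3 * solG₀ 0 := by norm_num [solG₀]; ring
      have e2 : solG₁ (1 / 2) = 4 / 3 * solG₁ 0 := by norm_num [solG₁]; ring
      rw [ansatz531_eq_add, ansatz531_eq_add 0 (solG₀ 0), e0, e1, e2, Complex.ofReal_zero]
      push_cast
      module
    rw [e, sub_mulVec, smul_mulVec, smul_mulVec]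
    exact h
  obtain ⟨d, hd, hdiag⟩ := exists_diagonal_eq
  have hdW : ∀ v ∈ W, diagonal d *ᵥ v ∈ W := by
    intro v hv
    rw [← hdiag, sub_mulVec, smul_mulVec, smul_mulVec, sum_mulVec]
    refine W.sub_mem (W.smul_mem _ (W.sum_mem fun k _ => ?_)) (W.smul_mem _ (hrep 2 v hv))
    rw [← mulVec_mulVec]
    exact hrep k _ (hrep k v hv)
  have hsingle : ∀ {v : Idx531 → ℂ}, v ∈ W → ∀ {a}, v a ≠ 0 → Pi.single a 1 ∈ W :=
    fun {v} hv {a} ha => single_mem_of_diagonal hd hdW hv ha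
  -- A nonzero entry of a skew-Hermitian matrix preserving `W` connects two weight vectors.
  have hedge : ∀ {M : Matrix Idx531 Idx531 ℂ}, (∀ v ∈ W, M *ᵥ v ∈ W) → Mᴴ = -M →
      ∀ {a b}, M a b ≠ 0 → ((Pi.single a 1 ∈ W) ↔ (Pi.single b 1 ∈ W)) := by
    intro M hM hskew a b hab
    have hba : M b a ≠ 0 := by
      have h := congrFun (congrFun hskew b) a
      rw [conjTranspose_apply, Matrix.neg_apply] at h
      rw [← neg_ne_zero, ← h]
      exact star_ne_zero.2 hab
    refine ⟨fun h => hsingle (hM _ h) ?_, fun h => hsingle (hM _ h) ?_⟩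
    · rwa [mulVec_single_one]
    · rwa [mulVec_single_one]
  have hT := fun i => (isSu_complexAnsatz (B₃ := B₃) (B₁ := B₁) 0 0 (solG₀ 0) (solG₁ 0) i).1
  simp only [← ansatz531_eq_complexAnsatz] at hT
  have r2 : rootTwo ≠ 0 := by intro h; simpa [h] using rootTwo_sq
  have r3 : rootThree ≠ 0 := by intro h; simpa [h] using rootThree_sq
  have g0 : solG₀ 0 ≠ 0 := by simp [solG₀]
  have g1 : solG₁ 0 ≠ 0 := by simp [solG₁]
  have hY := fun {a b : Idx531} => hedge (hrep 0) (conjTranspose_rep531 0) (a := a) (b := b)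
  have e1 := hY (a := .inl 0) (b := .inl 1) (by
    change irrep 5 0 0 1 ≠ 0; simp [irrep_five_zero])
  have e2 := hY (a := .inl 1) (b := .inl 2) (by
    change irrep 5 0 1 2 ≠ 0; simp [irrep_five_zero, r2, r3])
  have e3 := hY (a := .inl 2) (b := .inl 3) (by
    change irrep 5 0 2 3 ≠ 0; simp [irrep_five_zero, r2, r3])
  have e4 := hY (a := .inl 3) (b := .inl 4) (by
    change irrep 5 0 3 4 ≠ 0; simp [irrep_five_zero])
  have e5 := hY (a := .inr (.inl 0)) (b := .inr (.inl 1)) (by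
    change irrep 3 0 0 1 ≠ 0; simp [irrep_three_zero, r2])
  have e6 := hY (a := .inr (.inl 1)) (b := .inr (.inl 2)) (by
    change irrep 3 0 1 2 ≠ 0; simp [irrep_three_zero, r2])
  have e7 := hedge (h0 2) (hT 2) (a := .inl 1) (b := .inr (.inl 0)) (by
    change (solG₁ 0 : ℂ) * B₃ 2 1 0 ≠ 0
    exact mul_ne_zero (by exact_mod_cast g1) h₃.apply_two_one_zero_ne_zero₃)
  have e8 := hedge (h0 2) (hT 2) (a := .inr (.inl 1)) (b := .inr (.inr 0)) (by
    change (solG₀ 0 : ℂ) * B₁ 2 1 0 ≠ 0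
    exact mul_ne_zero (by exact_mod_cast g0) h₁.apply_two_one_zero_ne_zero₁)
  obtain ⟨a, ha⟩ := Function.ne_iff.1 hv0
  have hall := forall_of_iff (P := fun a => Pi.single a 1 ∈ W) e1 e2 e3 e4 e5 e6 e7 e8
    (hsingle hv ha)
  refine eq_top_iff.2 fun w _ => ?_
  rw [pi_eq_sum_univ' w]
  exact W.sum_mem fun b _ => W.smul_mem _ (hall b)

end Irreducible

end ExplicitSolution

/-! ### The representation at the poles -/

section Residue

variable {B₃ : Fin 3 → Matrix (Fin 5) (Fin 3) ℂ} {B₁ : Fin 3 → Matrix (Fin 3) (Fin 1) ℂ}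

/-- At `f₁ = f₂ = 1/2`, `g₀² = 2/3`, `g₁² = 1/2` the right-hand sides of the reduced system return
these values, so that the ansatz satisfies the commutation relations. -/
theorem isSO3Rep_complexAnsatz (h₃ : IsInvariantTriple 3 B₃) (h₁ : IsInvariantTriple 1 B₁)
    {g₀ g₁ : ℝ} (hg₀ : g₀ ^ 2 = 2 / 3) (hg₁ : g₁ ^ 2 = 1 / 2) :
    IsSO3Rep (complexAnsatz B₃ B₁ (1 / 2) (1 / 2) g₀ g₁) := by
  refine isSO3Rep_of_commutator fun i => ?_
  rw [complexAnsatz_commutator h₃ h₁]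
  simp only [Complex.normSq_ofReal, ← sq, hg₀, hg₁]
  congr 1 <;> norm_num

/-- The map `V₃ → V₅ ⊕ V₃ ⊕ V₁` with components `Bₖ`, `β Yₖ`, `γ Dₖ*`, where `B` and `D` are the
invariant triples. For suitable `β` and `γ` these maps embed three orthogonal copies of `V₃`. -/
noncomputable def tripleEmbedding (B₃ : Fin 3 → Matrix (Fin 5) (Fin 3) ℂ)
    (B₁ : Fin 3 → Matrix (Fin 3) (Fin 1) ℂ) (β γ : ℂ) (k : Fin 3) : Matrix Idx531 (Fin 3) ℂ :=
  fromRows (B₃ k) (fromRows (β • irrep 3 k) (γ • (B₁ k)ᴴ))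

theorem complexAnsatz_mul_tripleEmbedding (h₃ : IsInvariantTriple 3 B₃)
    (h₁ : IsInvariantTriple 1 B₁) {g₀ g₁ : ℝ} (hg₀ : g₀ ^ 2 = 2 / 3) (hg₁ : g₁ ^ 2 = 1 / 2)
    (i k : Fin 3) :
    complexAnsatz B₃ B₁ (1 / 2) (1 / 2) g₀ g₁ i * tripleEmbedding B₃ B₁ g₁ (g₀ * g₁) k =
      tripleEmbedding B₃ B₁ g₁ (g₀ * g₁) k * irrep 3 i := by
  have hg₀' : (g₀ : ℂ) ^ 2 = 2 / 3 := by rw [← Complex.ofReal_pow, hg₀]; norm_num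
  have hg₁' : (g₁ : ℂ) ^ 2 = 1 / 2 := by rw [← Complex.ofReal_pow, hg₁]; norm_num
  have e1 := h₃.mul_irrep i k
  have e2 := h₃.irrep_mul_irrep h₁ i k
  have e3 := congrArg Matrix.conjTranspose (h₁.irrep_three_mul_swap i k)
  simp only [conjTranspose_mul, conjTranspose_neg, conjTranspose_irrep, Matrix.mul_neg] at e3
  have hmul : complexAnsatz B₃ B₁ (1 / 2) (1 / 2) g₀ g₁ i *
      tripleEmbedding B₃ B₁ g₁ (g₀ * g₁) k = fromRows
        ((1 / 2 : ℂ) • (irrep 5 i * B₃ k) + ((g₁ : ℂ) ^ 2) • (B₃ i * irrep 3 k))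
        (fromRows (-((g₁ : ℂ) • ((B₃ i)ᴴ * B₃ k)) + (1 / 2 * g₁ : ℂ) • (irrep 3 i * irrep 3 k) +
          ((g₀ : ℂ) ^ 2 * g₁) • (B₁ i * (B₁ k)ᴴ))
          (-((g₀ * g₁ : ℂ) • ((B₁ i)ᴴ * irrep 3 k)))) := by
    ext (a | a | a) b <;>
      simp [complexAnsatz, tripleEmbedding, blockMatrix, mul_apply, Fintype.sum_sum_type,
        Finset.mul_sum] <;> ring_nf
    exact Finset.sum_congr rfl fun x _ => by ring
  rw [hmul, hg₀', hg₁', tripleEmbedding, fromRows_mul, fromRows_mul]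
  congr 1
  · exact e1.symm
  · congr 1
    · rw [Matrix.smul_mul, e2]
      module
    · rw [Matrix.smul_mul]
      linear_combination (norm := module) (g₀ * g₁ : ℂ) • e3

theorem sum_tripleEmbedding_mul_conjTranspose (h₃ : IsInvariantTriple 3 B₃)
    (h₁ : IsInvariantTriple 1 B₁) {g₀ g₁ : ℝ} (hg₀ : g₀ ^ 2 = 2 / 3) (hg₁ : g₁ ^ 2 = 1 / 2) :
    ∑ k, tripleEmbedding B₃ B₁ g₁ (g₀ * g₁) k * (tripleEmbedding B₃ B₁ g₁ (g₀ * g₁) k)ᴴ = 1 := by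
  have hg₁' : (g₁ : ℂ) * g₁ = 1 / 2 := by
    rw [← sq, ← Complex.ofReal_pow, hg₁]; norm_num
  have hg₀₁ : (g₀ * g₁ : ℂ) * (g₀ * g₁) = 1 / 3 := by
    rw [mul_mul_mul_comm, hg₁', ← sq, ← Complex.ofReal_pow, hg₀]; norm_num
  -- The factor `1` makes the sum over `k` an instance of `sum_smul_blockMatrix`.
  have hmul : ∀ k, tripleEmbedding B₃ B₁ g₁ (g₀ * g₁) k *
      (tripleEmbedding B₃ B₁ g₁ (g₀ * g₁) k)ᴴ = (1 : ℂ) • blockMatrix (B₃ k * (B₃ k)ᴴ)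
        (-(g₁ : ℂ) • (B₃ k * irrep 3 k)) ((g₀ * g₁ : ℂ) • (B₃ k * B₁ k))
        (-(g₁ : ℂ) • (B₃ k * irrep 3 k))ᴴ (-(1 / 2 : ℂ) • (irrep 3 k * irrep 3 k))
        ((g₁ * (g₀ * g₁) : ℂ) • (irrep 3 k * B₁ k))
        ((g₀ * g₁ : ℂ) • (B₃ k * B₁ k))ᴴ ((g₁ * (g₀ * g₁) : ℂ) • (irrep 3 k * B₁ k))ᴴ
        ((1 / 3 : ℂ) • ((B₁ k)ᴴ * B₁ k)) := by
    intro k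
    have e : tripleEmbedding B₃ B₁ g₁ (g₀ * g₁) k * (tripleEmbedding B₃ B₁ g₁ (g₀ * g₁) k)ᴴ =
        blockMatrix (B₃ k * (B₃ k)ᴴ) (B₃ k * ((g₁ : ℂ) • irrep 3 k)ᴴ)
          (B₃ k * ((g₀ * g₁ : ℂ) • (B₁ k)ᴴ)ᴴ)
          (((g₁ : ℂ) • irrep 3 k) * (B₃ k)ᴴ) (((g₁ : ℂ) • irrep 3 k) * ((g₁ : ℂ) • irrep 3 k)ᴴ)
          (((g₁ : ℂ) • irrep 3 k) * ((g₀ * g₁ : ℂ) • (B₁ k)ᴴ)ᴴ)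
          (((g₀ * g₁ : ℂ) • (B₁ k)ᴴ) * (B₃ k)ᴴ) (((g₀ * g₁ : ℂ) • (B₁ k)ᴴ) *
          ((g₁ : ℂ) • irrep 3 k)ᴴ) (((g₀ * g₁ : ℂ) • (B₁ k)ᴴ) * ((g₀ * g₁ : ℂ) • (B₁ k)ᴴ)ᴴ) := by
      ext (a | a | a) (b | b | b) <;> rfl
    rw [e, one_smul, ← hg₁', ← hg₀₁]
    simp only [conjTranspose_smul, conjTranspose_mul, conjTranspose_irrep, Matrix.smul_mul,
      Matrix.mul_smul, Matrix.mul_neg, Matrix.neg_mul, smul_neg, neg_smul, smul_smul,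
      conjTranspose_conjTranspose, conjTranspose_neg, RCLike.star_def, Complex.conj_ofReal,
      map_mul, neg_neg, mul_comm]
  have hYB : ∀ k, irrep 3 k * B₁ k = 0 := by
    intro k
    have h := h₁.irrep_three_mul_swap k k
    ext a b
    exact self_eq_neg.1 (congrFun (congrFun h a) b)
  simp only [hmul]
  rw [sum_smul_blockMatrix]
  simp only [one_smul, hYB]
  simp only [← Finset.smul_sum, ← conjTranspose_sum, h₃.2, h₃.sum_mul_irrep, h₃.sum_mul h₁,
    sum_irrep_three_mul_self, h₁.sum_conjTranspose_mul, smul_smul, smul_zero, conjTranspose_zero,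
    Finset.sum_const_zero]
  rw [← blockMatrix_one]
  norm_num

/-- The representation given by the residues is a sum of three copies of `V₃`, which are embedded by
the invariant triples. -/
theorem repIso_rep333 (h₃ : IsInvariantTriple 3 B₃) (h₁ : IsInvariantTriple 1 B₁) {g₀ g₁ : ℝ}
    (hg₀ : g₀ ^ 2 = 2 / 3) (hg₁ : g₁ ^ 2 = 1 / 2) :
    RepIso (complexAnsatz B₃ B₁ (1 / 2) (1 / 2) g₀ g₁) rep333 := by
  set Q : Matrix Idx531 (Fin 3 × Fin 3) ℂ :=
    Matrix.of fun a p => tripleEmbedding B₃ B₁ g₁ (g₀ * g₁) p.2 a p.1 with hQ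
  have hQQ : Q * Qᴴ = 1 := by
    rw [← sum_tripleEmbedding_mul_conjTranspose h₃ h₁ hg₀ hg₁]
    ext a b
    rw [mul_apply, Fintype.sum_prod_type_right, Matrix.sum_apply]
    rfl
  have hQQ' : Qᴴ * Q = 1 := (mul_eq_one_comm_of_card_eq _ _ _ (by simp)).1 hQQ
  have hZQ : ∀ i, complexAnsatz B₃ B₁ (1 / 2) (1 / 2) g₀ g₁ i * Q = Q * rep333 i := by
    intro i
    ext a p
    have h := congrFun (congrFun
      (complexAnsatz_mul_tripleEmbedding h₃ h₁ hg₀ hg₁ i p.2) a) p.1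
    refine h.trans ?_
    rw [mul_apply, mul_apply, Fintype.sum_prod_type]
    refine Finset.sum_congr rfl fun b _ => ?_
    simp [hQ, rep333, blockDiagonal_apply]
  have hZ : ∀ i, Qᴴ * complexAnsatz B₃ B₁ (1 / 2) (1 / 2) g₀ g₁ i = rep333 i * Qᴴ := by
    intro i
    calc Qᴴ * complexAnsatz B₃ B₁ (1 / 2) (1 / 2) g₀ g₁ i
        = Qᴴ * (complexAnsatz B₃ B₁ (1 / 2) (1 / 2) g₀ g₁ i * Q) * Qᴴ := by
          rw [Matrix.mul_assoc, Matrix.mul_assoc, hQQ, Matrix.mul_one]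
      _ = rep333 i * Qᴴ := by rw [hZQ, ← Matrix.mul_assoc, hQQ', Matrix.one_mul]
  refine ⟨LinearEquiv.ofLinearMap Qᴴ.mulVecLin Q.mulVecLin ?_ ?_, fun i v => ?_⟩
  · rw [← mulVecLin_mul, hQQ', mulVecLin_one]
  · rw [← mulVecLin_mul, hQQ, mulVecLin_one]
  · change Qᴴ *ᵥ (_ *ᵥ v) = rep333 i *ᵥ (Qᴴ *ᵥ v)
    rw [mulVec_mulVec, mulVec_mulVec, hZ]

end Residue

/-! ### Residues of the explicit solution -/

section Residues531

variable {B₃ : Fin 3 → Matrix (Fin 5) (Fin 3) ℂ} {B₁ : Fin 3 → Matrix (Fin 3) (Fin 1) ℂ}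

theorem hasSimplePoleAt_sol :
    HasSimplePoleAt solF 1 (-(1 / 2)) ∧ HasSimplePoleAt solF (-1) (-(1 / 2)) ∧
      HasSimplePoleAt solG₀ 1 (√(2 / 3)) ∧ HasSimplePoleAt solG₀ (-1) (-√(2 / 3)) ∧
      HasSimplePoleAt solG₁ 1 (1 / √2) ∧ HasSimplePoleAt solG₁ (-1) (-(1 / √2)) := by
  have h1 : (1 : ℝ) ^ 2 = 1 := one_pow 2
  have h2 : (-1 : ℝ) ^ 2 = 1 := by norm_num
  have p : √(2 / 3) ≠ 0 := by positivity
  have q : 1 / √2 ≠ 0 := by positivity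
  exact ⟨⟨by norm_num, hasResidueAt_solF h1⟩, ⟨by norm_num, hasResidueAt_solF h2⟩,
    ⟨p, by simpa using hasResidueAt_solG₀ h1⟩, ⟨neg_ne_zero.2 p, by simpa using hasResidueAt_solG₀ h2⟩,
    ⟨q, by simpa using hasResidueAt_solG₁ h1⟩, ⟨neg_ne_zero.2 q, by simpa using hasResidueAt_solG₁ h2⟩⟩

theorem neg_ansatz531 (f g₀ g₁ : ℝ) (i : Fin 3) :
    -ansatz531 B₃ B₁ (-f) (-f) g₀ g₁ i =
      complexAnsatz B₃ B₁ f f ((-g₀ : ℝ) : ℂ) ((-g₁ : ℝ) : ℂ) i := by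
  rw [← ansatz531_eq_complexAnsatz, ansatz531_eq_add, ansatz531_eq_add f]
  push_cast
  module

/-- At both poles the residues of the explicit solution form `V₃ ⊕ V₃ ⊕ V₃`. -/
theorem exists_residues_sol (h₃ : IsInvariantTriple 3 B₃) (h₁ : IsInvariantTriple 1 B₁) {s : ℝ}
    (hs : s ^ 2 = 1) : ∃ R : Fin 3 → Matrix Idx531 Idx531 ℂ,
      (∀ i a b, HasResidueAt
        (fun t => ansatz531 B₃ B₁ (solF t) (solF t) (solG₀ t) (solG₁ t) i a b) s (R i a b)) ∧
      (∀ i, IsSu (R i)) ∧ IsSO3Rep (fun i => -R i) ∧ RepIso (fun i => -R i) rep333 := by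
  have hg₀ : (-(s * √(2 / 3))) ^ 2 = 2 / 3 := by
    rw [neg_sq, mul_pow, hs, Real.sq_sqrt (by norm_num), one_mul]
  have hg₁ : (-(s * (1 / √2))) ^ 2 = 1 / 2 := by
    rw [neg_sq, mul_pow, hs, div_pow, Real.sq_sqrt (by norm_num), one_mul, one_pow]
  refine ⟨ansatz531 B₃ B₁ (-(1 / 2)) (-(1 / 2)) (s * √(2 / 3)) (s * (1 / √2)),
    fun i a b => hasResidueAt_ansatz531 (hasResidueAt_solF hs) (hasResidueAt_solG₀ hs)
      (hasResidueAt_solG₁ hs) i a b, fun i => ?_, ?_, ?_⟩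
  · rw [ansatz531_eq_complexAnsatz]
    exact isSu_complexAnsatz _ _ _ _ i
  · simp only [neg_ansatz531]
    exact isSO3Rep_complexAnsatz h₃ h₁ hg₀ hg₁
  · simp only [neg_ansatz531]
    exact repIso_rep333 h₃ h₁ hg₀ hg₁

end Residues531

theorem mainTheorem5 :
    -- the invariant triples exist
    (∃ B₃, IsInvariantTriple 3 B₃) ∧ (∃ B₁, IsInvariantTriple 1 B₁) ∧
    ∀ (B₃ : Fin 3 → Matrix (Fin 5) (Fin 3) ℂ) (B₁ : Fin 3 → Matrix (Fin 3) (Fin 1) ℂ),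
    IsInvariantTriple 3 B₃ → IsInvariantTriple 1 B₁ →
    -- the general spherically symmetric solution
    (∀ (I : Set ℝ) (T : ℝ → Fin 3 → Matrix Idx531 Idx531 ℂ) (Y : Fin 3 → Matrix Idx531 Idx531 ℂ),
      IsNahmSolution T I → IsSphericallySymmetric T I → AreGenerators Y T I →
      IsSO3Rep Y → RepIso Y rep531 →
      ∃ U ∈ Matrix.specialUnitaryGroup Idx531 ℂ,
        (∀ i, U * Y i * Uᴴ = rep531 i) ∧
        ∃ f₁ f₂ g₀ g₁ : ℝ → ℝ,
          AnalyticOnNhd ℝ f₁ I ∧ AnalyticOnNhd ℝ f₂ I ∧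
          AnalyticOnNhd ℝ g₀ I ∧ AnalyticOnNhd ℝ g₁ I ∧
          (∀ t ∈ I, ∀ i,
            U * T t i * Uᴴ = ansatz531 B₃ B₁ (f₁ t) (f₂ t) (g₀ t) (g₁ t) i) ∧
          IsSolution531 f₁ f₂ g₀ g₁ I) ∧
    -- the explicit solution of the reduced system, and its poles
    IsMaximalSolution531 solF solF solG₀ solG₁ (Ioo (-1) 1) ∧
    (HasSimplePoleAt solF 1 (-(1 / 2)) ∧ HasSimplePoleAt solF (-1) (-(1 / 2)) ∧
      HasSimplePoleAt solG₀ 1 (Real.sqrt (2 / 3)) ∧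
      HasSimplePoleAt solG₀ (-1) (-Real.sqrt (2 / 3)) ∧
      HasSimplePoleAt solG₁ 1 (1 / Real.sqrt 2) ∧
      HasSimplePoleAt solG₁ (-1) (-(1 / Real.sqrt 2))) ∧
    -- the corresponding Nahm datum
    (∀ T : ℝ → Fin 3 → Matrix Idx531 Idx531 ℂ,
      (∀ t, T t = ansatz531 B₃ B₁ (solF t) (solF t) (solG₀ t) (solG₁ t)) →
      IsMaximalNahmSolution T (Ioo (-1) 1) ∧
      IsSphericallySymmetric T (Ioo (-1) 1) ∧
      AreGenerators rep531 T (Ioo (-1) 1) ∧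
      IsIrreducibleDatum T (Ioo (-1) 1) ∧
      ∀ t₀ : ℝ, t₀ = 1 ∨ t₀ = -1 →
        ∃ R : Fin 3 → Matrix Idx531 Idx531 ℂ,
          (∀ i a b, HasResidueAt (fun t => T t i a b) t₀ (R i a b)) ∧
          (∀ i, IsSu (R i)) ∧
          IsSO3Rep (fun i => -R i) ∧
          RepIso (fun i => -R i) rep333) := by
  refine ⟨⟨_, isInvariantTriple_stdTriple₃⟩, ⟨_, isInvariantTriple_stdTriple₁⟩,
    fun B₃ B₁ h₃ h₁ => ⟨fun I T Y hT _ hY _ hiso =>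
      exists_ansatz531_of_areGenerators h₃ h₁ hT hY hiso, isMaximalSolution531_sol,
      hasSimplePoleAt_sol, fun T hT => ?_⟩⟩
  obtain rfl : T = fun t => ansatz531 B₃ B₁ (solF t) (solF t) (solG₀ t) (solG₁ t) := funext hT
  have hG := areGenerators_ansatz531 h₃ h₁ solF solF solG₀ solG₁ (Ioo (-1) 1)
  refine ⟨isMaximalNahmSolution_sol h₃ h₁, isSphericallySymmetric_of_areGenerators hG, hG,
    isIrreducibleDatum_sol h₃ h₁, fun t₀ ht₀ => exists_residues_sol h₃ h₁ ?_⟩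
  rcases ht₀ with rfl | rfl <;> norm_num
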